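/- Let $\Omega$ be a finite set, $q=\ln|\Omega|$, and let $H:\Omega\to\{0,\dots,n\}$ attain the value $0$. Put $Z(\beta)=\sum_{x}e^{-\beta H(x)}$, $\mu_\beta(x)=e^{-\beta H(x)}/Z(\beta)$, and let $|\mu_\beta\rangle=\sum_x\sqrt{\mu_\beta(x)}\,|x\rangle$ be the Gibbs state and $R_\beta=2|\mu_\beta\rangle\langle\mu_\beta|-I$ the reflection about it. Assume $\ln n\ge1$, $\ln q\ge1$, and that $n\ge10$ or $q\ln n\ge36$ (this last condition excludes only finitely many pairs $(n,|\Omega|)$). Let $0\le\beta_0<\beta_{\max}\le q$ and $0<\delta<1$. Quantum algorithms are adaptive programs that act on a system register $\mathbb C^\Omega$ and a finite-dimensional workspace by operations that do not depend on $H$ (unitaries and measurements, free of charge) and by reflections $R_\beta$ on the system register, controlled on the workspace, at inverse temperatures of their choice (cost one each). The *quantum schedule generation procedure* starts with one copy of $|\mu_{\beta_0}\rangle$ and $k=0$. While $\beta_k<\beta_{\max}$, it finds $\beta_{k+1}$ by binary search with precision $1/(2n)$ on $[\beta_k,q]$ for the predicate $|\langle\mu_{\beta_k}|\mu_\beta\rangle|^2\ge0.075$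 of $\beta$, moves its register from $|\mu_{\beta_k}\rangle$ to $|\mu_{\beta_{k+1}}\rangle$, and increases $k$ by one. Finally it outputs $\beta_0,\dots,\beta_{k-1},\beta_{\max}$. Here binary search on $[a,b]$ returns $b$ if the predicate tests true at $b$; otherwise it sets $\lambda=a$, $\rho=b$ and, while $\rho-\lambda$ exceeds the precision, tests the midpoint and replaces $\lambda$ (if true) or $\rho$ (if false) by it, and returns $\lambda$. Overlaps are evaluated by non-destructive amplitude estimation with additive error $0.005$: a subroutine with parameter $\eta\in(0,1/2]$ that, started in $|\mu_\beta\rangle$, outputs with probability at least $1-\eta$ an estimate of $|\langle\mu_\beta|\mu_{\beta'}\rangle|^2$ with this error, restores $|\mu_\beta\rangle$ with probability at least $1-\eta$, and uses $O(\ln(1/\eta))$ reflections. The moving subroutine turns $|\mu_\beta\rangle$ into $|\mu_{\beta'}\rangle$ with probability at least $1-\eta$ whenever $|\langle\mu_\beta|\mu_{\beta'}\rangle|^2\ge1/15$, and uses $O(\ln(1/\eta))$ reflections. The procedure calls them with $\eta=\delta/\big(16\sqrt{q\ln n}\,(\ln q+\ln n)\big)$ and $\eta=\delta/(2\sqrt{q\ln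 n})$ respectively. **Theorem.** Such subroutines exist, as programs that do not depend on $H$, and with them the following holds. With probability at least $1-\delta$, the quantum schedule generation procedure terminates after at most $\sqrt{q\ln n}$ iterations of its main loop, outputs a $15$-slowly-varying cooling schedule of length $\ell\le\sqrt{q\ln n}$ from $\beta_0$ to $\beta_{\max}$, that is, inverse temperatures $\beta_0<\beta_1<\dots<\beta_\ell=\beta_{\max}$ with $$\frac{Z(\beta_i)\,Z(\beta_{i+1})}{Z\big(\tfrac{\beta_i+\beta_{i+1}}2\big)^2}\le15\qquad(0\le i<\ell),$$ and uses $$O\Big(\sqrt{q\ln n}\,(\ln q+\ln n)\,\big(\ln q+\ln\ln n+\ln(1/\delta)\big)\Big)$$ reflections about Gibbs states at different inverse temperatures. All constants in $O(\cdot)$ are universal. -/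

import Mathlib

open scoped Matrix

noncomputable section

namespace GibbsSchedule

universe u

/-! ## Gibbs distributions and their coherent encodings -/

/-- The partition function `Z(β) = ∑ x, exp (-β H(x))`. -/
def Z {Ω : Type u} [Fintype Ω] (H : Ω → ℕ) (β : ℝ) : ℝ :=
  ∑ x, Real.exp (-β * (H x : ℝ))

/-- The Gibbs distribution `μ_β(x) = exp (-β H(x)) / Z(β)`. -/
def gibbs {Ω : Type u} [Fintype Ω] (H : Ω → ℕ) (β : ℝ) (x : Ω) : ℝ :=
  Real.exp (-β * (H x : ℝ)) / Z H β

/-- The Gibbs state (qsample) `|μ_β⟩ = ∑ x, √(μ_β(x)) |x⟩`. -/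
def qsample {Ω : Type u} [Fintype Ω] (H : Ω → ℕ) (β : ℝ) : Ω → ℂ :=
  fun x => ((Real.sqrt (gibbs H β x) : ℝ) : ℂ)

/-- The overlap `|⟨μ_β | μ_β'⟩|²`. -/
def overlap {Ω : Type u} [Fintype Ω] (H : Ω → ℕ) (β β' : ℝ) : ℝ :=
  ‖star (qsample H β) ⬝ᵥ qsample H β'‖ ^ 2

/-- The reflection `R_β = 2 |μ_β⟩⟨μ_β| - 1` about the Gibbs state. -/
def reflection {Ω : Type u} [Fintype Ω] [DecidableEq Ω] (H : Ω → ℕ) (β : ℝ) :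
    Matrix Ω Ω ℂ :=
  (2 : ℂ) • Matrix.vecMulVec (qsample H β) (star (qsample H β)) - 1

/-! ## Cooling schedules -/

/-- The list `β₀ < β₁ < ⋯ < β_ℓ = βmax`; its length as a schedule is `ℓ = l.length - 1`. -/
def IsCoolingSchedule (β₀ βmax : ℝ) (l : List ℝ) : Prop :=
  l.head? = some β₀ ∧ l.getLast? = some βmax ∧ l.IsChain (· < ·)

/-- `Z(β_i) Z(β_{i+1}) / Z((β_i + β_{i+1}) / 2)² ≤ c` for all consecutive temperatures. -/
def SlowlyVarying {Ω : Type u} [Fintype Ω] (H : Ω → ℕ) (c : ℝ) (l : List ℝ) : Prop :=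
  l.IsChain (fun a b => Z H a * Z H b / Z H ((a + b) / 2) ^ 2 ≤ c)

/-! ## Quantum algorithms with access to reflections about Gibbs states

The quantum memory has a system register with basis `Ω` and a workspace register with basis
`Fin d`.  A program never mentions the Hamiltonian: it acts on it only through queries. -/

/-- A vector in `ℂ^Ω ⊗ ℂ^d`; measurement branches carry subnormalized vectors. -/
abbrev State (Ω : Type u) (d : ℕ) : Type u := Ω × Fin d → ℂ

/-- Adaptive quantum query algorithms with a classical output of type `α`. -/
inductive Prog (Ω : Type u) [Fintype Ω] [DecidableEq Ω] (d : ℕ) (α : Type) : Type u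
  /-- Stop with a classical output. -/
  | ret (a : α) : Prog Ω d α
  /-- Apply a fixed unitary (free of charge). -/
  | unitary (U : Matrix.unitaryGroup (Ω × Fin d) ℂ) (k : Prog Ω d α) : Prog Ω d α
  /-- Apply the reflection about the Gibbs state at inverse temperature `β` to the system
  register, controlled on the workspace basis state `w` satisfying `c w` (cost one). -/
  | query (β : ℝ) (c : Fin d → Bool) (k : Prog Ω d α) : Prog Ω d α
  /-- Measure the function `f` of the computational basis, continue depending on the outcome. -/
  | measure (f : Ω × Fin d → ℕ) (k : ℕ → Prog Ω d α) : Prog Ω d α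

namespace Prog

/-- Sequential composition. -/
def bind {Ω : Type u} [Fintype Ω] [DecidableEq Ω] {d : ℕ} {α γ : Type} :
    Prog Ω d α → (α → Prog Ω d γ) → Prog Ω d γ
  | ret a, g => g a
  | unitary U k, g => unitary U (k.bind g)
  | query β c k, g => query β c (k.bind g)
  | measure f k, g => measure f (fun o => (k o).bind g)

instance {Ω : Type u} [Fintype Ω] [DecidableEq Ω] {d : ℕ} : Monad (Prog Ω d) where
  pure := ret
  bind := bind

/-- No run of the program makes more than `N` queries. -/
def QueriesLe {Ω : Type u} [Fintype Ω] [DecidableEq Ω] {d : ℕ} {α : Type} :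
    Prog Ω d α → ℕ → Prop
  | ret _, _ => True
  | unitary _ k, N => k.QueriesLe N
  | query _ _ _, 0 => False
  | query _ _ k, N + 1 => k.QueriesLe N
  | measure _ k, N => ∀ o, (k o).QueriesLe N

end Prog

/-- The squared norm of a (subnormalized) state. -/
def normSq {Ω : Type u} [Fintype Ω] {d : ℕ} (φ : State Ω d) : ℝ :=
  ∑ i, ‖φ i‖ ^ 2

/-- The reflection `R_β` on the system register, controlled on the workspace. -/
def applyReflection {Ω : Type u} [Fintype Ω] [DecidableEq Ω] {d : ℕ} (H : Ω → ℕ) (β : ℝ)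
    (c : Fin d → Bool) (φ : State Ω d) : State Ω d :=
  fun i => if c i.2 then (reflection H β *ᵥ fun y => φ (y, i.2)) i.1 else φ i

/-- The component of `φ` on which the measured function `f` has the value `o`. -/
def branch {Ω : Type u} {d : ℕ} (f : Ω × Fin d → ℕ) (o : ℕ) (φ : State Ω d) : State Ω d :=
  fun i => if f i = o then φ i else 0

/-- The sum, over all branches of the run of a program on the state `φ` for the Hamiltonian `H`,
of `F a t φ'`, where `a` is the output of the branch, `t` its number of queries (counted from the
given start value) and `φ'` its final subnormalized state, of squared norm the probability of the
branch. -/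
def sumBranches {Ω : Type u} [Fintype Ω] [DecidableEq Ω] {d : ℕ} {α : Type} (H : Ω → ℕ) :
    Prog Ω d α → ℕ → State Ω d → (α → ℕ → State Ω d → ℝ) → ℝ
  | .ret a, t, φ, F => F a t φ
  | .unitary U k, t, φ, F => sumBranches H k t (U.1 *ᵥ φ) F
  | .query β c k, t, φ, F => sumBranches H k (t + 1) (applyReflection H β c φ) F
  | .measure f k, t, φ, F =>
      ∑ o ∈ Finset.univ.image f, sumBranches H (k o) t (branch f o φ) F

open Classical in
/-- The probability that the run of `p` on the unit vector `φ` has an output, a number of queries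
and a final state (up to normalization) that satisfy `E`. -/
def prob {Ω : Type u} [Fintype Ω] [DecidableEq Ω] {d : ℕ} {α : Type} (H : Ω → ℕ)
    (p : Prog Ω d α) (φ : State Ω d) (E : α → ℕ → State Ω d → Prop) : ℝ :=
  sumBranches H p 0 φ (fun a t φ' => if E a t φ' then normSq φ' else 0)

/-- The state `|μ_β⟩ ⊗ |0⟩`. -/
def gibbsInit {Ω : Type u} [Fintype Ω] {d : ℕ} [NeZero d] (H : Ω → ℕ) (β : ℝ) : State Ω d :=
  fun i => if i.2 = 0 then qsample H β i.1 else 0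

/-- `φ` is the state `|μ_β⟩ ⊗ |0⟩` up to a scalar (phase and normalization). -/
def IsGibbs {Ω : Type u} [Fintype Ω] {d : ℕ} [NeZero d] (H : Ω → ℕ) (β : ℝ)
    (φ : State Ω d) : Prop :=
  ∃ c : ℂ, φ = c • gibbsInit H β

/-! ## The quantum schedule generation procedure -/

/-- The quantum subroutines of schedule generation, as programs (independent of the Hamiltonian):
`estimate η β β'` is run on `|μ_β⟩` and outputs an estimate of `|⟨μ_β | μ_β'⟩|²`;
`move η β β'` is to turn `|μ_β⟩` into `|μ_β'⟩`; `η` is the permitted failure probability. -/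
structure Subroutines (Ω : Type u) [Fintype Ω] [DecidableEq Ω] (d : ℕ) where
  estimate : ℝ → ℝ → ℝ → Prog Ω d ℝ
  move : ℝ → ℝ → ℝ → Prog Ω d Unit

/-- Non-destructive amplitude estimation with additive error `0.005`: started in `|μ_β⟩`, with
probability at least `1 - η` the estimate of `|⟨μ_β | μ_β'⟩|²` is accurate, with probability at
least `1 - η` the state `|μ_β⟩` is restored, and at most `C ln (1 / η)` reflections are made. -/
def Subroutines.EstimateCorrect {Ω : Type u} [Fintype Ω] [DecidableEq Ω] {d : ℕ} [NeZero d]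
    (S : Subroutines Ω d) (C : ℝ) (H : Ω → ℕ) : Prop :=
  ∀ η β β' : ℝ, 0 < η → η ≤ 1 / 2 → 0 ≤ β → 0 ≤ β' →
    1 - η ≤ prob H (S.estimate η β β') (gibbsInit H β)
      (fun p _ _ => |p - overlap H β β'| ≤ 0.005) ∧
    1 - η ≤ prob H (S.estimate η β β') (gibbsInit H β) (fun _ _ φ => IsGibbs H β φ) ∧
    ∃ N : ℕ, (N : ℝ) ≤ C * Real.log (1 / η) ∧ (S.estimate η β β').QueriesLe N

/-- Moving between Gibbs states of overlap at least `1 / 15`: started in `|μ_β⟩`, with probability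
at least `1 - η` the final state is `|μ_β'⟩`, and at most `C ln (1 / η)` reflections are made. -/
def Subroutines.MoveCorrect {Ω : Type u} [Fintype Ω] [DecidableEq Ω] {d : ℕ} [NeZero d]
    (S : Subroutines Ω d) (C : ℝ) (H : Ω → ℕ) : Prop :=
  ∀ η β β' : ℝ, 0 < η → η ≤ 1 / 2 → 0 ≤ β → 0 ≤ β' →
    (1 / 15 ≤ overlap H β β' →
      1 - η ≤ prob H (S.move η β β') (gibbsInit H β) (fun _ _ φ => IsGibbs H β' φ)) ∧
    ∃ N : ℕ, (N : ℝ) ≤ C * Real.log (1 / η) ∧ (S.move η β β').QueriesLe N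

open Classical in
/-- The loop of binary search: while `hi - lo > prec`, test the midpoint of `[lo, hi]` and replace
`lo` or `hi` by it.  The natural number bounds the number of iterations. -/
def binarySearchLoop {Ω : Type u} [Fintype Ω] [DecidableEq Ω] {d : ℕ}
    (test : ℝ → Prog Ω d Bool) (prec : ℝ) : ℕ → ℝ → ℝ → Prog Ω d ℝ
  | 0, lo, _ => pure lo
  | N + 1, lo, hi =>
    if prec < hi - lo then do
      let t ← test ((lo + hi) / 2)
      if t then binarySearchLoop test prec N ((lo + hi) / 2) hi
      else binarySearchLoop test prec N lo ((lo + hi) / 2)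
    else pure lo

/-- Binary search on `[a, b]` with precision `prec`.  The interval is halved in each iteration, so
the bound `⌈log₂ ((b - a) / prec)⌉` on the number of iterations never stops the loop early. -/
def binarySearch {Ω : Type u} [Fintype Ω] [DecidableEq Ω] {d : ℕ}
    (test : ℝ → Prog Ω d Bool) (a b prec : ℝ) : Prog Ω d ℝ := do
  let t ← test b
  if t then pure b
  else binarySearchLoop test prec ⌈Real.logb 2 ((b - a) / prec)⌉₊ a b

open Classical in
/-- The predicate `|⟨μ_β | μ_β'⟩|² ≥ 0.075` of `β'`, evaluated on the estimated overlap. -/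
def overlapTest {Ω : Type u} [Fintype Ω] [DecidableEq Ω] {d : ℕ} (S : Subroutines Ω d)
    (η β β' : ℝ) : Prog Ω d Bool := do
  let p ← S.estimate η β β'
  pure (decide (0.075 ≤ p))

open Classical in
/-- The main loop: while `β_k < βmax`, find `β_{k+1}` by binary search on `[β_k, q]` with precision
`1 / (2n)` and move the quantum register to `|μ_{β_{k+1}}⟩`.  The list `l` holds
`β₀, …, β_{k-1}`; when `β_k ≥ βmax` the schedule is closed with `βmax`.  The natural number is a cap
on the number of iterations, `none` being returned when it is exceeded. -/
def scheduleLoop {Ω : Type u} [Fintype Ω] [DecidableEq Ω] {d : ℕ} (S : Subroutines Ω d)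
    (n : ℕ) (q βmax η η' : ℝ) : ℕ → ℝ → List ℝ → Prog Ω d (Option (List ℝ))
  | 0, β, l => pure (if β < βmax then none else some (l ++ [βmax]))
  | T + 1, β, l =>
    if β < βmax then do
      let β' ← binarySearch (overlapTest S η β) β q (1 / (2 * n))
      S.move η' β β'
      scheduleLoop S n q βmax η η' T β' (l ++ [β])
    else pure (some (l ++ [βmax]))

/-- Quantum schedule generation, with `q = ln |Ω|` and at most `T` iterations of the main loop.  The
failure probabilities permitted to the subroutines are fractions of `δ`. -/
def quantumSchedule {Ω : Type u} [Fintype Ω] [DecidableEq Ω] {d : ℕ} (S : Subroutines Ω d)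
    (n : ℕ) (β₀ βmax δ : ℝ) (T : ℕ) : Prog Ω d (Option (List ℝ)) :=
  let q : ℝ := Real.log (Fintype.card Ω)
  let L : ℝ := Real.sqrt (q * Real.log n)
  scheduleLoop S n q βmax (δ / (16 * L * (Real.log q + Real.log n))) (δ / (2 * L)) T β₀ []

end GibbsSchedule

end

open scoped Matrix

noncomputable section

namespace GibbsSchedule

universe u

set_option linter.unusedSectionVars false

/-! ### Branch sums: composition, linearity, conservation of norm. -/

section Runs

variable {Ω : Type u} [Fintype Ω] [DecidableEq Ω] {d : ℕ} {α γ : Type}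

/-! ## Runs of programs -/

/-! Write f = ln Z and E = -f'. The overlap of two Gibbs states is exp(-g), where g(a,b) = f(a) +
f(b) - 2f((a+b)/2), and the ratio in the conclusion is exp(g). So a step whose overlap is at least
0.07 is 15-slowly varying and can be made by the moving subroutine. What has to be shown is that the
greedy steps are few.

Unless binary search returns q, it returns a step with g ≥ 2: the rejected endpoint has overlap at
most 0.08, hence g ≥ 5/2, and since E ≤ n, backing up by 1/(2n) costs at most 1/2. Convexity of f
shows that on such a long step the drop of f times the drop of ln E is at least 4
(`four_le_logZ_sub_mul_log`). By Cauchy–Schwarz, k long steps force 4k² ≤ (total drop of f)(total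
drop of ln E). The first factor is at most q, because H attains 0. The second is at most ln n + ln
2, because E ≥ 1/2 wherever a long step starts. The numerical assumptions turn this into k + 2 ≤ √(q
ln n) (`LongSteps.add_two_le`), which leaves room for a final step that need not be long.

Both subroutines alternate the measurement of P, the projection onto ψ = |μ_β⟩|0⟩, with that of a
projection Q built from |μ_β'⟩. The states stay on two lines, and the outcomes are governed by r =
⟨ψ|Q|ψ⟩, an affine function of the overlap. In estimation, each outcome of Q agrees with the
preceding outcome of P with probability r, independently, so a Chernoff bound applies; then the walk
continues until it hits ψ again. In moving, the walk runs until Q accepts. Each measurement costs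
one reflection. Errors and queries are added up by `prob_bind` and `scheduleLoop_correct`. -/

theorem Prog.bind_eq (p : Prog Ω d α) (g : α → Prog Ω d γ) : p >>= g = p.bind g := rfl

theorem sumBranches_bind (H : Ω → ℕ) (p : Prog Ω d α) (g : α → Prog Ω d γ) (t : ℕ)
    (φ : State Ω d) (F : γ → ℕ → State Ω d → ℝ) :
    sumBranches H (p.bind g) t φ F =
      sumBranches H p t φ (fun a s φ' => sumBranches H (g a) s φ' F) := by
  induction p generalizing t φ with
  | ret a => rfl
  | unitary U k ih => exact ih _ _
  | query β c k ih => exact ih _ _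
  | measure f k ih => exact Finset.sum_congr rfl fun o _ => ih o _ _

theorem sumBranches_shift (H : Ω → ℕ) (p : Prog Ω d α) (t s : ℕ) (φ : State Ω d)
    (F : α → ℕ → State Ω d → ℝ) :
    sumBranches H p (t + s) φ F = sumBranches H p s φ (fun a s φ' => F a (t + s) φ') := by
  induction p generalizing s φ with
  | ret a => rfl
  | unitary U k ih => exact ih _ _
  | query β c k ih => exact ih (s + 1) _
  | measure f k ih => exact Finset.sum_congr rfl fun o _ => ih o _ _

/-- A comparison is needed only at query counts that the program can reach. This is how the query
bound of a first stage becomes available to the analysis of the second. -/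
theorem sumBranches_mono_of_queriesLe (H : Ω → ℕ) {p : Prog Ω d α} {N : ℕ} (hp : p.QueriesLe N)
    (t : ℕ) (φ : State Ω d) {F G : α → ℕ → State Ω d → ℝ}
    (h : ∀ a s φ', s ≤ t + N → F a s φ' ≤ G a s φ') :
    sumBranches H p t φ F ≤ sumBranches H p t φ G := by
  induction p generalizing t φ N with
  | ret a => exact h _ _ _ (Nat.le_add_right _ _)
  | unitary U k ih => exact ih hp _ _ h
  | query β c k ih =>
    cases N with
    | zero => exact hp.elim
    | succ N => exact ih hp _ _ fun a s φ' hs => h a s φ' (by omega)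
  | measure f k ih => exact Finset.sum_le_sum fun o _ => ih o (hp o) _ _ h

theorem sumBranches_mono (H : Ω → ℕ) (p : Prog Ω d α) (t : ℕ) (φ : State Ω d)
    {F G : α → ℕ → State Ω d → ℝ} (h : ∀ a s φ', F a s φ' ≤ G a s φ') :
    sumBranches H p t φ F ≤ sumBranches H p t φ G := by
  induction p generalizing t φ with
  | ret a => exact h _ _ _
  | unitary U k ih => exact ih _ _
  | query β c k ih => exact ih _ _
  | measure f k ih => exact Finset.sum_le_sum fun o _ => ih o _ _

theorem sumBranches_add (H : Ω → ℕ) (p : Prog Ω d α) (t : ℕ) (φ : State Ω d)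
    (F G : α → ℕ → State Ω d → ℝ) :
    sumBranches H p t φ (fun a s φ' => F a s φ' + G a s φ') =
      sumBranches H p t φ F + sumBranches H p t φ G := by
  induction p generalizing t φ with
  | ret a => rfl
  | unitary U k ih => exact ih _ _
  | query β c k ih => exact ih _ _
  | measure f k ih =>
    simp only [sumBranches, ih, Finset.sum_add_distrib]

theorem sumBranches_const_mul (H : Ω → ℕ) (p : Prog Ω d α) (t : ℕ) (φ : State Ω d) (r : ℝ)
    (F : α → ℕ → State Ω d → ℝ) :
    sumBranches H p t φ (fun a s φ' => r * F a s φ') = r * sumBranches H p t φ F := by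
  induction p generalizing t φ with
  | ret a => rfl
  | unitary U k ih => exact ih _ _
  | query β c k ih => exact ih _ _
  | measure f k ih =>
    simp only [sumBranches, ih, Finset.mul_sum]

theorem applyReflection_smul (H : Ω → ℕ) (β : ℝ) (c : Fin d → Bool) (z : ℂ) (φ : State Ω d) :
    applyReflection H β c (z • φ) = z • applyReflection H β c φ := by
  ext i
  have h : (fun y => (z • φ) (y, i.2)) = z • fun y => φ (y, i.2) := rfl
  rw [applyReflection, h, Matrix.mulVec_smul, Pi.smul_apply, Pi.smul_apply, Pi.smul_apply,
    applyReflection]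
  split_ifs <;> rfl

theorem branch_smul (f : Ω × Fin d → ℕ) (o : ℕ) (z : ℂ) (φ : State Ω d) :
    branch f o (z • φ) = z • branch f o φ := by
  ext i
  simp [branch]

theorem sumBranches_smul (H : Ω → ℕ) (p : Prog Ω d α) (t : ℕ) (z : ℂ) (φ : State Ω d)
    (F : α → ℕ → State Ω d → ℝ) :
    sumBranches H p t (z • φ) F = sumBranches H p t φ (fun a s φ' => F a s (z • φ')) := by
  induction p generalizing t φ with
  | ret a => rfl
  | unitary U k ih => simp only [sumBranches, Matrix.mulVec_smul, ih]
  | query β c k ih => simp only [sumBranches, applyReflection_smul, ih]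
  | measure f k ih => simp only [sumBranches, branch_smul, ih]

/-! ### Norms -/

theorem normSq_nonneg (φ : State Ω d) : 0 ≤ normSq φ :=
  Finset.sum_nonneg fun _ _ => by positivity

theorem normSq_smul (z : ℂ) (φ : State Ω d) : normSq (z • φ) = ‖z‖ ^ 2 * normSq φ := by
  simp [normSq, mul_pow, Finset.mul_sum]

theorem sum_normSq_branch (f : Ω × Fin d → ℕ) (φ : State Ω d) :
    ∑ o ∈ Finset.univ.image f, normSq (branch f o φ) = normSq φ := by
  unfold normSq
  rw [Finset.sum_comm]
  refine Finset.sum_congr rfl fun i _ => ?_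
  rw [Finset.sum_eq_single (f i)]
  · simp [branch]
  · intro b _ hb
    simp [branch, hb.symm]
  · intro h
    simp at h

theorem ofReal_sum_norm_sq {ι : Type*} [Fintype ι] (v : ι → ℂ) :
    ((∑ i, ‖v i‖ ^ 2 : ℝ) : ℂ) = star v ⬝ᵥ v := by
  simp only [dotProduct, Pi.star_apply, Complex.ofReal_sum]
  refine Finset.sum_congr rfl fun i _ => ?_
  rw [RCLike.star_def, mul_comm, Complex.mul_conj, Complex.normSq_eq_norm_sq]

theorem sum_norm_sq_unitary_mulVec {ι : Type*} [Fintype ι] [DecidableEq ι] {U : Matrix ι ι ℂ}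
    (hU : Uᴴ * U = 1) (v : ι → ℂ) : ∑ i, ‖(U *ᵥ v) i‖ ^ 2 = ∑ i, ‖v i‖ ^ 2 := by
  have h : ((∑ i, ‖(U *ᵥ v) i‖ ^ 2 : ℝ) : ℂ) = ((∑ i, ‖v i‖ ^ 2 : ℝ) : ℂ) := by
    rw [ofReal_sum_norm_sq, ofReal_sum_norm_sq, Matrix.star_mulVec, ← Matrix.dotProduct_mulVec,
      Matrix.mulVec_mulVec, hU, Matrix.one_mulVec]
  exact_mod_cast h

theorem normSq_unitary_mulVec (U : Matrix.unitaryGroup (Ω × Fin d) ℂ) (φ : State Ω d) :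
    normSq (U.1 *ᵥ φ) = normSq φ :=
  sum_norm_sq_unitary_mulVec (Matrix.mem_unitaryGroup_iff'.1 U.2) φ

section Nonempty

variable [Nonempty Ω]

theorem Z_pos (H : Ω → ℕ) (β : ℝ) : 0 < Z H β :=
  Finset.sum_pos (fun _ _ => Real.exp_pos _) Finset.univ_nonempty

theorem gibbs_pos (H : Ω → ℕ) (β : ℝ) (x : Ω) : 0 < gibbs H β x :=
  div_pos (Real.exp_pos _) (Z_pos H β)

theorem sum_gibbs (H : Ω → ℕ) (β : ℝ) : ∑ x, gibbs H β x = 1 := by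
  simp only [gibbs, ← Finset.sum_div]
  exact div_self (Z_pos H β).ne'

theorem star_qsample (H : Ω → ℕ) (β : ℝ) : star (qsample H β) = qsample H β := by
  ext x
  simp [qsample]

theorem sum_norm_sq_qsample (H : Ω → ℕ) (β : ℝ) : ∑ x, ‖qsample H β x‖ ^ 2 = 1 := by
  rw [← sum_gibbs H β]
  refine Finset.sum_congr rfl fun x _ => ?_
  rw [qsample, Complex.norm_real, Real.norm_eq_abs, sq_abs, Real.sq_sqrt (gibbs_pos H β x).le]

theorem qsample_dotProduct_self (H : Ω → ℕ) (β : ℝ) : qsample H β ⬝ᵥ qsample H β = 1 := by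
  have h := ofReal_sum_norm_sq (qsample H β)
  rw [sum_norm_sq_qsample, star_qsample] at h
  exact_mod_cast h.symm

theorem reflection_mulVec (H : Ω → ℕ) (β : ℝ) (v : Ω → ℂ) :
    reflection H β *ᵥ v = (2 * (qsample H β ⬝ᵥ v)) • qsample H β - v := by
  rw [reflection, Matrix.sub_mulVec, Matrix.one_mulVec, Matrix.smul_mulVec,
    Matrix.vecMulVec_mulVec, star_qsample]
  congr 1
  ext x
  simp
  ring

theorem conjTranspose_reflection_mul_self (H : Ω → ℕ) (β : ℝ) :
    (reflection H β)ᴴ * reflection H β = 1 := by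
  have h : (reflection H β)ᴴ = reflection H β := by
    simp [reflection, Matrix.conjTranspose_vecMulVec]
  rw [h]
  apply Matrix.ext_of_mulVec_single
  intro i
  rw [← Matrix.mulVec_mulVec, reflection_mulVec, reflection_mulVec, Matrix.one_mulVec,
    dotProduct_sub, dotProduct_smul, qsample_dotProduct_self]
  ext x
  simp
  ring

theorem normSq_applyReflection (H : Ω → ℕ) (β : ℝ) (c : Fin d → Bool) (φ : State Ω d) :
    normSq (applyReflection H β c φ) = normSq φ := by
  simp only [normSq, Fintype.sum_prod_type_right, applyReflection]
  refine Finset.sum_congr rfl fun w _ => ?_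
  split_ifs
  · exact sum_norm_sq_unitary_mulVec (conjTranspose_reflection_mul_self H β) fun y => φ (y, w)
  · rfl

theorem sumBranches_normSq (H : Ω → ℕ) (p : Prog Ω d α) (t : ℕ) (φ : State Ω d) :
    sumBranches H p t φ (fun _ _ φ' => normSq φ') = normSq φ := by
  induction p generalizing t φ with
  | ret a => rfl
  | unitary U k ih => simp only [sumBranches, ih, normSq_unitary_mulVec]
  | query β c k ih => simp only [sumBranches, ih, normSq_applyReflection]
  | measure f k ih => simp only [sumBranches, ih, sum_normSq_branch]

theorem normSq_gibbsInit [NeZero d] (H : Ω → ℕ) (β : ℝ) :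
    normSq (gibbsInit H β : State Ω d) = 1 := by
  simp only [normSq, Fintype.sum_prod_type_right, gibbsInit]
  rw [Finset.sum_eq_single 0]
  · simpa using sum_norm_sq_qsample H β
  · intro w _ hw
    simp [hw]
  · simp

/-! ### Probabilities of events -/

theorem prob_true (H : Ω → ℕ) (p : Prog Ω d α) (φ : State Ω d) :
    prob H p φ (fun _ _ _ => True) = normSq φ := by
  simp only [prob, if_true, sumBranches_normSq]

/-- Union bound: the weights of the two events add up to at most the weight of their intersection
plus the total weight 1. -/
theorem prob_and (H : Ω → ℕ) {p : Prog Ω d α} {φ : State Ω d} (hφ : normSq φ = 1)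
    {E E' : α → ℕ → State Ω d → Prop} {ε ε' : ℝ} (h : 1 - ε ≤ prob H p φ E)
    (h' : 1 - ε' ≤ prob H p φ E') :
    1 - (ε + ε') ≤ prob H p φ (fun a s φ' => E a s φ' ∧ E' a s φ') := by
  classical
  have key : prob H p φ E + prob H p φ E' ≤
      prob H p φ (fun a s φ' => E a s φ' ∧ E' a s φ') + prob H p φ (fun _ _ _ => True) := by
    simp only [prob, ← sumBranches_add]
    refine sumBranches_mono H p 0 φ fun a s φ' => ?_
    have := normSq_nonneg φ'
    split_ifs <;> first | tauto | linarith
  rw [prob_true, hφ] at key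
  linarith

/-- Sequential composition of two programs which succeed with high probability: the first one
prepares a Gibbs state and the second one starts in it. -/
theorem prob_bind [NeZero d] (H : Ω → ℕ) {p : Prog Ω d α} {g : α → Prog Ω d γ} {N : ℕ} {β : ℝ}
    {β' : α → ℝ} {A : α → Prop} {E : γ → ℕ → State Ω d → Prop} {ε ε' : ℝ} (hε' : 0 ≤ ε') (hε : 0 ≤ ε)
    (hE : ∀ b s φ (c : ℂ), E b s φ → E b s (c • φ)) (hN : p.QueriesLe N)
    (hp : 1 - ε ≤ prob H p (gibbsInit H β) (fun a _ φ => A a ∧ IsGibbs H (β' a) φ))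
    (hg : ∀ a, A a → ∀ s ≤ N,
      1 - ε' ≤ prob H (g a) (gibbsInit H (β' a)) (fun b t φ => E b (s + t) φ)) :
    1 - (ε + ε') ≤ prob H (p >>= g) (gibbsInit H β) E := by
  classical
  -- The main estimate multiplies 1 - ε ≤ prob by 1 - ε', so it needs ε' < 1; otherwise the claimed
  -- bound is nonpositive.
  rcases le_or_gt 1 ε' with h1 | h1
  · have : 0 ≤ prob H (p >>= g) (gibbsInit H β) E := by
      have h := sumBranches_mono H (p >>= g) 0 (gibbsInit H β)
        (F := fun _ _ φ => 0 * normSq φ) (G := fun a t φ' => if E a t φ' then normSq φ' else 0)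
        fun a s φ' => by
          have := normSq_nonneg φ'
          split_ifs <;> linarith
      rw [sumBranches_const_mul] at h
      simpa [prob] using h
    linarith
  have key : (1 - ε') * prob H p (gibbsInit H β) (fun a _ φ => A a ∧ IsGibbs H (β' a) φ) ≤
      prob H (p >>= g) (gibbsInit H β) E := by
    rw [prob, prob, ← sumBranches_const_mul, Prog.bind_eq, sumBranches_bind]
    refine sumBranches_mono_of_queriesLe H hN 0 _ fun a s φ hs => ?_
    split_ifs with h
    -- By linearity, a branch that ends in c times a Gibbs state contributes ‖c‖² times the success
    -- probability from the Gibbs state itself.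
    · obtain ⟨hA, c, rfl⟩ := h
      have h2 := hg a hA s (by omega)
      rw [sumBranches_smul, normSq_smul, normSq_gibbsInit, mul_one, mul_comm]
      refine (mul_le_mul_of_nonneg_left h2 (sq_nonneg _)).trans ?_
      have h3 := sumBranches_shift H (g a) s 0 (gibbsInit H (β' a))
        (fun b t φ' => if E b t (c • φ') then normSq (c • φ') else 0)
      rw [add_zero] at h3
      rw [h3, prob, ← sumBranches_const_mul]
      refine sumBranches_mono H _ _ _ fun b t φ' => ?_
      have h4 := normSq_nonneg (c • φ')
      by_cases h5 : E b (s + t) φ'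
      · rw [if_pos h5, if_pos (hE _ _ _ c h5), normSq_smul]
      · rw [if_neg h5, mul_zero]
        split_ifs
        exacts [h4, le_rfl]
    · rw [mul_zero]
      have h := sumBranches_mono H (g a) s φ
        (F := fun _ _ φ => 0 * normSq φ) (G := fun a t φ' => if E a t φ' then normSq φ' else 0)
        fun a s φ' => by
          have := normSq_nonneg φ'
          split_ifs <;> linarith
      rwa [sumBranches_const_mul, zero_mul] at h
  nlinarith

end Nonempty

end Runs

/-! ### Measuring a Gibbs projection with one reflection. -/

section Gadgets

open scoped Kronecker

variable {Ω : Type u} [Fintype Ω] [DecidableEq Ω] [Nonempty Ω]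

/-! ## Projective measurements with one query

The workspace has the four levels `0, 1, 2, 3`; level `3` is a scratch level, which is empty
between the measurements. -/

/-- The unitary that acts on the workspace as a Hermitian involution `W`. -/
def workspaceUnitary (W : Matrix (Fin 4) (Fin 4) ℂ) (h : Wᴴ = W) (h' : W * W = 1) :
    Matrix.unitaryGroup (Ω × Fin 4) ℂ :=
  ⟨(1 : Matrix Ω Ω ℂ) ⊗ₖ W, Matrix.kronecker_mem_unitary (one_mem _)
    (Matrix.mem_unitaryGroup_iff.2 (by rw [Matrix.star_eq_conjTranspose, h, h']))⟩

theorem workspaceUnitary_mulVec (W : Matrix (Fin 4) (Fin 4) ℂ) (h : Wᴴ = W) (h' : W * W = 1)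
    (φ : State Ω 4) (x : Ω) (w : Fin 4) :
    ((workspaceUnitary W h h').1 *ᵥ φ) (x, w) = ∑ v, W w v * φ (x, v) := by
  simp only [workspaceUnitary, Matrix.mulVec, dotProduct, Fintype.sum_prod_type,
    Matrix.kroneckerMap_apply]
  rw [Finset.sum_eq_single x]
  · simp
  · intro y _ hy
    simp [Matrix.one_apply_ne hy.symm]
  · simp

/-- The amplitude `1 / √2`. -/
def invSqrtTwo : ℂ := ((Real.sqrt 2)⁻¹ : ℝ)

theorem invSqrtTwo_mul_self : invSqrtTwo * invSqrtTwo = 1 / 2 := by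
  rw [invSqrtTwo, ← Complex.ofReal_mul, ← mul_inv, Real.mul_self_sqrt (by norm_num)]
  norm_num

theorem star_invSqrtTwo : (starRingEnd ℂ) invSqrtTwo = invSqrtTwo :=
  Complex.conj_ofReal _

/-- The Hadamard transform on the levels `0` and `3`. -/
def hadamardMatrix : Matrix (Fin 4) (Fin 4) ℂ :=
  !![invSqrtTwo, 0, 0, invSqrtTwo; 0, 1, 0, 0; 0, 0, 1, 0; invSqrtTwo, 0, 0, -invSqrtTwo]

/-- The transposition of the levels `0` and `3`. -/
def swapMatrix : Matrix (Fin 4) (Fin 4) ℂ :=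
  !![0, 0, 0, 1; 0, 1, 0, 0; 0, 0, 1, 0; 1, 0, 0, 0]

/-- An involution that takes level `0` to the superposition `(1, 2, 2) / 3` of the first three
levels. -/
def mixMatrix : Matrix (Fin 4) (Fin 4) ℂ :=
  !![1 / 3, 2 / 3, 2 / 3, 0; 2 / 3, 1 / 3, -(2 / 3), 0; 2 / 3, -(2 / 3), 1 / 3, 0; 0, 0, 0, 1]

def hadamard : Matrix.unitaryGroup (Ω × Fin 4) ℂ :=
  workspaceUnitary hadamardMatrix
    (by
      ext i j
      fin_cases i <;> fin_cases j <;>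
        simp [hadamardMatrix, Matrix.conjTranspose_apply, star_invSqrtTwo])
    (by
      have h := invSqrtTwo_mul_self
      ext i j
      fin_cases i <;> fin_cases j <;>
        simp [hadamardMatrix, Matrix.mul_apply, Fin.sum_univ_four, h] <;> norm_num)

def levelSwap : Matrix.unitaryGroup (Ω × Fin 4) ℂ :=
  workspaceUnitary swapMatrix
    (by
      ext i j
      fin_cases i <;> fin_cases j <;> simp [swapMatrix, Matrix.conjTranspose_apply])
    (by
      ext i j
      fin_cases i <;> fin_cases j <;> simp [swapMatrix, Matrix.mul_apply, Fin.sum_univ_four])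

def mix : Matrix.unitaryGroup (Ω × Fin 4) ℂ :=
  workspaceUnitary mixMatrix
    (by
      ext i j
      fin_cases i <;> fin_cases j <;> simp [mixMatrix, Matrix.conjTranspose_apply])
    (by
      ext i j
      fin_cases i <;> fin_cases j <;>
        simp [mixMatrix, Matrix.mul_apply, Fin.sum_univ_four] <;> norm_num)

theorem mix_mulVec_mix_mulVec (φ : State Ω 4) :
    (mix : Matrix.unitaryGroup (Ω × Fin 4) ℂ).1 *ᵥ
      ((mix : Matrix.unitaryGroup (Ω × Fin 4) ℂ).1 *ᵥ φ) = φ := by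
  ext ⟨x, w⟩
  simp only [mix, workspaceUnitary_mulVec, Fin.sum_univ_four]
  fin_cases w <;> simp [mixMatrix] <;> ring

/-- The scratch level of `φ` is empty. -/
def Clean (φ : State Ω 4) : Prop := ∀ x, φ (x, 3) = 0

theorem Clean.smul {φ : State Ω 4} (h : Clean φ) (c : ℂ) : Clean (c • φ) := fun x => by
  simp [h x]

theorem Clean.sub {φ φ' : State Ω 4} (h : Clean φ) (h' : Clean φ') : Clean (φ - φ') :=
  fun x => by simp [h x, h' x]

theorem Clean.mix {φ : State Ω 4} (h : Clean φ) :
    Clean ((mix : Matrix.unitaryGroup (Ω × Fin 4) ℂ).1 *ᵥ φ) := fun x => by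
  simp [GibbsSchedule.mix, workspaceUnitary_mulVec, Fin.sum_univ_four, mixMatrix, h x]

theorem clean_gibbsInit (H : Ω → ℕ) (β : ℝ) : Clean (gibbsInit H β) := fun x => by
  simp [gibbsInit]

/-- The projection onto `|μ_β⟩ ⊗ |0⟩`, or onto the sum of its span and of the level `1` of the
workspace if `y` is true. -/
def gibbsProj (H : Ω → ℕ) (β : ℝ) (y : Bool) : State Ω 4 →ₗ[ℂ] State Ω 4 where
  toFun φ i :=
    if i.2 = 0 then (qsample H β ⬝ᵥ fun x => φ (x, 0)) * qsample H β i.1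
    else if y = true ∧ i.2 = 1 then φ i else 0
  map_add' φ φ' := by
    ext i
    simp only [Pi.add_apply]
    rw [show (fun x => φ (x, 0) + φ' (x, 0)) = (fun x => φ (x, 0)) + fun x => φ' (x, 0) from rfl,
      dotProduct_add]
    split_ifs <;> ring
  map_smul' c φ := by
    ext i
    simp only [Pi.smul_apply, RingHom.id_apply]
    rw [show (fun x => c • φ (x, 0)) = c • fun x => φ (x, 0) from rfl, dotProduct_smul]
    split_ifs <;> simp [mul_assoc]

theorem gibbsProj_apply (H : Ω → ℕ) (β : ℝ) (y : Bool) (φ : State Ω 4) (i : Ω × Fin 4) :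
    gibbsProj H β y φ i =
      if i.2 = 0 then (qsample H β ⬝ᵥ fun x => φ (x, 0)) * qsample H β i.1
      else if y = true ∧ i.2 = 1 then φ i else 0 := rfl

theorem clean_gibbsProj (H : Ω → ℕ) (β : ℝ) (y : Bool) (φ : State Ω 4) :
    Clean (gibbsProj H β y φ) := fun x => by
  simp [gibbsProj_apply]

theorem gibbsProj_gibbsProj (H : Ω → ℕ) (β : ℝ) (y : Bool) (φ : State Ω 4) :
    gibbsProj H β y (gibbsProj H β y φ) = gibbsProj H β y φ := by
  ext i
  have h : (fun x => gibbsProj H β y φ (x, 0)) =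
      (qsample H β ⬝ᵥ fun x => φ (x, 0)) • qsample H β := by
    ext x
    simp [gibbsProj_apply]
  rw [gibbsProj_apply, h, dotProduct_smul, qsample_dotProduct_self]
  simp only [gibbsProj_apply]
  split_ifs <;> simp

theorem gibbsProj_false (H : Ω → ℕ) (β : ℝ) (φ : State Ω 4) :
    gibbsProj H β false φ = (qsample H β ⬝ᵥ fun x => φ (x, 0)) • gibbsInit H β := by
  ext i
  simp [gibbsProj_apply, gibbsInit]

/-- The projective measurement of `gibbsProj`, with one query. -/
def measureProj (β : ℝ) (y : Bool) : Prog Ω 4 Bool :=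
  .unitary hadamard (.query β (fun w => decide (w = 3)) (.unitary hadamard
    (.measure (fun i => if i.2 = 0 ∨ (y = true ∧ i.2 = 1) then 1 else 0) fun o =>
      if o = 1 then .ret true else .unitary levelSwap (.ret false))))

theorem queriesLe_measureProj (β : ℝ) (y : Bool) :
    (measureProj β y : Prog Ω 4 Bool).QueriesLe 1 := by
  intro o
  dsimp only
  split_ifs <;> trivial

/-- The level-0 component v becomes (v, v)/√2 on levels 0 and 3, then (v, Rv)/√2, then ((v + Rv)/2,
(v - Rv)/2). As R = 2P - 1, these are Pv and v - Pv: the scratch level flags rejection. -/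
theorem hadamard_query_hadamard (H : Ω → ℕ) (β : ℝ) {φ : State Ω 4} (hφ : Clean φ) (x : Ω)
    (w : Fin 4) :
    ((hadamard : Matrix.unitaryGroup (Ω × Fin 4) ℂ).1 *ᵥ
      applyReflection H β (fun w => decide (w = 3))
        ((hadamard : Matrix.unitaryGroup (Ω × Fin 4) ℂ).1 *ᵥ φ)) (x, w) =
      if w = 3 then φ (x, 0) - (qsample H β ⬝ᵥ fun x => φ (x, 0)) * qsample H β x
      else if w = 0 then (qsample H β ⬝ᵥ fun x => φ (x, 0)) * qsample H β x else φ (x, w) := by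
  have h3 : (fun y => ((hadamard : Matrix.unitaryGroup (Ω × Fin 4) ℂ).1 *ᵥ φ) (y, 3)) =
      invSqrtTwo • fun y => φ (y, 0) := by
    ext y
    simp [hadamard, workspaceUnitary_mulVec, Fin.sum_univ_four, hadamardMatrix, hφ y]
  have h4 : applyReflection H β (fun w => decide (w = 3))
      ((hadamard : Matrix.unitaryGroup (Ω × Fin 4) ℂ).1 *ᵥ φ) (x, 3) = invSqrtTwo *
        (2 * (qsample H β ⬝ᵥ fun x => φ (x, 0)) * qsample H β x - φ (x, 0)) := by
    simp only [applyReflection, decide_true, if_true, h3, Matrix.mulVec_smul, reflection_mulVec]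
    simp
  have h5 : ∀ v : Fin 4, v ≠ 3 → applyReflection H β (fun w => decide (w = 3))
      ((hadamard : Matrix.unitaryGroup (Ω × Fin 4) ℂ).1 *ᵥ φ) (x, v) =
      (if v = 0 then invSqrtTwo else 1) * φ (x, v) := by
    intro v hv
    simp only [applyReflection, hv, decide_false, Bool.false_eq_true, if_false]
    fin_cases v <;>
      simp_all [hadamard, workspaceUnitary_mulVec, Fin.sum_univ_four, hadamardMatrix, hφ x]
  have hs := invSqrtTwo_mul_self
  rw [hadamard, workspaceUnitary_mulVec, ← hadamard, Fin.sum_univ_four, h4, h5 0 (by decide),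
    h5 1 (by decide), h5 2 (by decide)]
  fin_cases w
  · simp [hadamardMatrix]
    linear_combination (2 * (qsample H β ⬝ᵥ fun x => φ (x, 0)) * qsample H β x) * hs
  · simp [hadamardMatrix]
  · simp [hadamardMatrix]
  · simp [hadamardMatrix]
    linear_combination (2 * φ (x, 0) -
      2 * (qsample H β ⬝ᵥ fun x => φ (x, 0)) * qsample H β x) * hs

/-- After rejection level 0 is empty and level 3 holds v - Pv, so `levelSwap` puts that component
back and leaves the scratch level clean. -/
theorem sumBranches_measureProj (H : Ω → ℕ) (β : ℝ) (y : Bool) (t : ℕ) {φ : State Ω 4}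
    (hφ : Clean φ) (F : Bool → ℕ → State Ω 4 → ℝ) :
    sumBranches H (measureProj β y) t φ F =
      F true (t + 1) (gibbsProj H β y φ) + F false (t + 1) (φ - gibbsProj H β y φ) := by
  have him : Finset.univ.image
      (fun i : Ω × Fin 4 => if i.2 = 0 ∨ (y = true ∧ i.2 = 1) then 1 else 0) = {1, 0} := by
    obtain ⟨x⟩ := ‹Nonempty Ω›
    ext o
    simp only [Finset.mem_image, Finset.mem_univ, true_and, Finset.mem_insert,
      Finset.mem_singleton]
    constructor
    · rintro ⟨i, rfl⟩
      split_ifs <;> simp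
    · rintro (rfl | rfl)
      · exact ⟨(x, 0), by simp⟩
      · exact ⟨(x, 3), by simp⟩
  simp only [measureProj, sumBranches]
  rw [him, Finset.sum_pair one_ne_zero]
  simp only [if_true, zero_ne_one, if_false, sumBranches]
  congr 2
  · ext ⟨x, w⟩
    simp only [branch, hadamard_query_hadamard H β hφ, gibbsProj_apply]
    fin_cases w <;> simp
  · ext ⟨x, w⟩
    rw [levelSwap, workspaceUnitary_mulVec, Fin.sum_univ_four]
    simp only [branch, hadamard_query_hadamard H β hφ, gibbsProj_apply, Pi.sub_apply]
    fin_cases w <;> simp [swapMatrix, hφ x]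
    cases y <;> simp

end Gadgets

/-! ### Query bounds, and the two-state walk of alternating measurements. -/

section Walk

variable {Ω : Type u} [Fintype Ω] [DecidableEq Ω]

theorem Prog.QueriesLe.mono {d : ℕ} {α : Type} {p : Prog Ω d α} {N M : ℕ} (hp : p.QueriesLe N)
    (h : N ≤ M) : p.QueriesLe M := by
  induction p generalizing N M with
  | ret a => cases M <;> trivial
  | unitary U k ih =>
    -- `QueriesLe` also matches on the bound, so it unfolds only once the bound is a constructor.
    have h1 : k.QueriesLe N := by cases N <;> exact hp
    have h2 := ih h1 h
    cases M <;> exact h2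
  | query β c k ih =>
    cases N with
    | zero => exact hp.elim
    | succ N =>
      cases M with
      | zero => omega
      | succ M => exact ih (N := N) hp (by omega)
  | measure f k ih =>
    have h1 : ∀ o, (k o).QueriesLe N := by cases N <;> exact hp
    have h2 : ∀ o, (k o).QueriesLe M := fun o => ih o (h1 o) h
    cases M <;> exact h2

theorem Prog.QueriesLe.unitary {d : ℕ} {α : Type} {k : Prog Ω d α} {N : ℕ}
    (U : Matrix.unitaryGroup (Ω × Fin d) ℂ) (h : k.QueriesLe N) :
    (Prog.unitary U k).QueriesLe N := by
  cases N <;> exact h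

theorem Prog.queriesLe_ret {d : ℕ} {α : Type} (a : α) (N : ℕ) :
    (Prog.ret a : Prog Ω d α).QueriesLe N := by
  cases N <;> trivial

theorem Prog.QueriesLe.bind {d : ℕ} {α γ : Type} {p : Prog Ω d α} {g : α → Prog Ω d γ} {N M : ℕ}
    (hp : p.QueriesLe N) (hg : ∀ a, (g a).QueriesLe M) : (p.bind g).QueriesLe (N + M) := by
  induction p generalizing N with
  | ret a => exact (hg a).mono (by omega)
  | unitary U k ih =>
    have h1 : k.QueriesLe N := by cases N <;> exact hp
    have h2 := ih h1
    change (Prog.unitary U (k.bind g)).QueriesLe (N + M)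
    generalize N + M = K at h2
    cases K <;> exact h2
  | query β c k ih =>
    cases N with
    | zero => exact hp.elim
    | succ N =>
      have h2 := ih (N := N) hp
      rw [show N + 1 + M = N + M + 1 by omega]
      exact h2
  | measure f k ih =>
    have h1 : ∀ o, (k o).QueriesLe N := by cases N <;> exact hp
    have h2 := fun o => ih o (h1 o)
    change (Prog.measure f fun o => (k o).bind g).QueriesLe (N + M)
    generalize N + M = K at h2
    cases K <;> exact h2

variable [Nonempty Ω]

/-! ## The walk between two projections

The register starts in `ψ = |μ_β⟩ ⊗ |0⟩`, and two projective measurements alternate: that of `Q`,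
which is `gibbsProj` for `β'` conjugated by `mix`, and that of the span of `ψ`.  All states are
multiples of `ψ` or of the component of `Q ψ` orthogonal to `ψ`, and whether the outcome of `Q`
agrees with the previous outcome is decided by independent coin tosses. -/

/-- The projection `gibbsProj` conjugated by `mix`. -/
def mixedProj (H : Ω → ℕ) (β : ℝ) (y : Bool) : State Ω 4 →ₗ[ℂ] State Ω 4 :=
  Matrix.mulVecLin (mix : Matrix.unitaryGroup (Ω × Fin 4) ℂ).1 ∘ₗ gibbsProj H β y ∘ₗ
    Matrix.mulVecLin (mix : Matrix.unitaryGroup (Ω × Fin 4) ℂ).1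

theorem mixedProj_apply (H : Ω → ℕ) (β : ℝ) (y : Bool) (φ : State Ω 4) :
    mixedProj H β y φ = (mix : Matrix.unitaryGroup (Ω × Fin 4) ℂ).1 *ᵥ
      gibbsProj H β y ((mix : Matrix.unitaryGroup (Ω × Fin 4) ℂ).1 *ᵥ φ) := rfl

theorem mixedProj_mixedProj (H : Ω → ℕ) (β : ℝ) (y : Bool) (φ : State Ω 4) :
    mixedProj H β y (mixedProj H β y φ) = mixedProj H β y φ := by
  simp only [mixedProj_apply, mix_mulVec_mix_mulVec, gibbsProj_gibbsProj]

theorem clean_mixedProj (H : Ω → ℕ) (β : ℝ) (y : Bool) (φ : State Ω 4) :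
    Clean (mixedProj H β y φ) :=
  (clean_gibbsProj H β y _).mix

/-- The projective measurement of `mixedProj`. -/
def measureMixed (β : ℝ) (y : Bool) : Prog Ω 4 Bool :=
  .unitary mix ((measureProj β y).bind fun o => .unitary mix (.ret o))

theorem queriesLe_measureMixed (β : ℝ) (y : Bool) :
    (measureMixed β y : Prog Ω 4 Bool).QueriesLe 1 :=
  .unitary _ (.bind (M := 0) (queriesLe_measureProj β y) fun _ =>
    .unitary _ (Prog.queriesLe_ret _ _))

theorem sumBranches_measureMixed (H : Ω → ℕ) (β : ℝ) (y : Bool) (t : ℕ) {φ : State Ω 4}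
    (hφ : Clean φ) (F : Bool → ℕ → State Ω 4 → ℝ) :
    sumBranches H (measureMixed β y) t φ F =
      F true (t + 1) (mixedProj H β y φ) + F false (t + 1) (φ - mixedProj H β y φ) := by
  simp only [measureMixed, sumBranches, sumBranches_bind]
  rw [sumBranches_measureProj H β y t hφ.mix, Matrix.mulVec_sub, mix_mulVec_mix_mulVec]
  rfl

/-- The probability that the measurement of `mixedProj` accepts `|μ_β⟩ ⊗ |0⟩`. -/
def acceptProb (H : Ω → ℕ) (β β' : ℝ) (y : Bool) : ℝ :=
  (overlap H β β' + if y then 4 else 0) / 9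

theorem dotProduct_qsample_mul_self (H : Ω → ℕ) (β β' : ℝ) :
    (qsample H β ⬝ᵥ qsample H β') * (qsample H β ⬝ᵥ qsample H β') = overlap H β β' := by
  have h : qsample H β ⬝ᵥ qsample H β' =
      ((∑ x, Real.sqrt (gibbs H β x) * Real.sqrt (gibbs H β' x) : ℝ) : ℂ) := by
    simp [dotProduct, qsample]
  rw [overlap, star_qsample, h, Complex.norm_real, Real.norm_eq_abs, sq_abs]
  push_cast
  ring

theorem overlap_le_one (H : Ω → ℕ) (β β' : ℝ) : overlap H β β' ≤ 1 := by
  have h : qsample H β ⬝ᵥ qsample H β' =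
      ((∑ x, Real.sqrt (gibbs H β x) * Real.sqrt (gibbs H β' x) : ℝ) : ℂ) := by
    simp [dotProduct, qsample]
  rw [overlap, star_qsample, h, Complex.norm_real, Real.norm_eq_abs, sq_abs]
  refine pow_le_one₀ (Finset.sum_nonneg fun _ _ => by positivity) ?_
  have h2 : ∑ x, Real.sqrt (gibbs H β x) * Real.sqrt (gibbs H β' x) ≤
      ∑ x, (gibbs H β x + gibbs H β' x) / 2 := by
    refine Finset.sum_le_sum fun x _ => ?_
    have h3 := Real.sq_sqrt (gibbs_pos H β x).le
    have h4 := Real.sq_sqrt (gibbs_pos H β' x).le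
    nlinarith [sq_nonneg (Real.sqrt (gibbs H β x) - Real.sqrt (gibbs H β' x))]
  rw [← Finset.sum_div, Finset.sum_add_distrib, sum_gibbs, sum_gibbs] at h2
  linarith

theorem overlap_nonneg (H : Ω → ℕ) (β β' : ℝ) : 0 ≤ overlap H β β' := sq_nonneg _

theorem gibbsProj_gibbsInit (H : Ω → ℕ) (β : ℝ) :
    gibbsProj H β false (gibbsInit H β) = gibbsInit H β := by
  rw [gibbsProj_false]
  have h : (fun x => (gibbsInit H β : State Ω 4) (x, 0)) = qsample H β := by
    ext x
    simp [gibbsInit]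
  rw [h, qsample_dotProduct_self, one_smul]

/-- `mix` distributes ψ over levels 0, 1, 2 with amplitudes 1/3, 2/3, 2/3. Level 0 contributes 1/9
of the overlap to acceptance, and level 1 contributes 4/9 when `y` is true. -/
theorem gibbsProj_mixedProj_gibbsInit (H : Ω → ℕ) (β β' : ℝ) (y : Bool) :
    gibbsProj H β false (mixedProj H β' y (gibbsInit H β)) =
      (acceptProb H β β' y : ℂ) • gibbsInit H β := by
  rw [gibbsProj_false]
  congr 1
  have h0 : ∀ x w, ((mix : Matrix.unitaryGroup (Ω × Fin 4) ℂ).1 *ᵥ gibbsInit H β) (x, w) =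
      mixMatrix w 0 * qsample H β x := by
    intro x w
    rw [mix, workspaceUnitary_mulVec, Fin.sum_univ_four]
    simp [gibbsInit]
  have h1 : (fun x => mixedProj H β' y (gibbsInit H β) (x, 0)) =
      ((qsample H β ⬝ᵥ qsample H β') / 9) • qsample H β' +
        (if y then (4 / 9 : ℂ) else 0) • qsample H β := by
    ext x
    have h2 : (fun x => ((mix : Matrix.unitaryGroup (Ω × Fin 4) ℂ).1 *ᵥ gibbsInit H β) (x, 0)) =
        (1 / 3 : ℂ) • qsample H β := by
      ext x
      rw [h0]
      simp [mixMatrix]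
    rw [mixedProj_apply, mix, workspaceUnitary_mulVec, ← mix, Fin.sum_univ_four]
    simp only [gibbsProj_apply, h2, dotProduct_smul]
    simp only [h0, dotProduct_comm (qsample H β')]
    cases y <;> simp [mixMatrix] <;> ring
  rw [h1, dotProduct_add, dotProduct_smul, dotProduct_smul, qsample_dotProduct_self, acceptProb]
  have h3 := dotProduct_qsample_mul_self H β β'
  push_cast
  rw [← h3]
  cases y <;> simp <;> ring

/-- The component of `Q ψ` orthogonal to `ψ`. -/
def walkPerp (H : Ω → ℕ) (β β' : ℝ) (y : Bool) : State Ω 4 :=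
  mixedProj H β' y (gibbsInit H β) - (acceptProb H β β' y : ℂ) • gibbsInit H β

/-- The two states of the walk, labelled by the outcome of the last measurement. -/
def walkState (H : Ω → ℕ) (β β' : ℝ) (y s : Bool) : State Ω 4 :=
  if s then gibbsInit H β else walkPerp H β β' y

theorem clean_walkState (H : Ω → ℕ) (β β' : ℝ) (y s : Bool) :
    Clean (walkState H β β' y s) := by
  have h := clean_gibbsInit H β
  unfold walkState
  split_ifs
  exacts [h, (clean_mixedProj H β' y _).sub (h.smul _)]

/-- Idempotence of Q keeps the walk inside the span of ψ and Qψ. -/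
theorem mixedProj_walkPerp (H : Ω → ℕ) (β β' : ℝ) (y : Bool) :
    mixedProj H β' y (walkPerp H β β' y) =
      (1 - acceptProb H β β' y : ℂ) • mixedProj H β' y (gibbsInit H β) := by
  rw [walkPerp, map_sub, map_smul, mixedProj_mixedProj, sub_smul, one_smul]

theorem gibbsProj_walkPerp (H : Ω → ℕ) (β β' : ℝ) (y : Bool) :
    gibbsProj H β false (walkPerp H β β' y) = 0 := by
  rw [walkPerp, map_sub, map_smul, gibbsProj_gibbsInit, gibbsProj_mixedProj_gibbsInit, sub_self]

/-- The amplitude of the transition of the walk from the state labelled `s` through the outcome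
`o` of `mixedProj` to the state labelled `s'`. -/
def walkAmp (r : ℝ) : Bool → Bool → Bool → ℝ
  | true, true, true => r
  | true, true, false => 1
  | true, false, true => 1 - r
  | true, false, false => -1
  | false, true, true => r * (1 - r)
  | false, true, false => 1 - r
  | false, false, true => -(r * (1 - r))
  | false, false, false => r

/-- Two consecutive measurements of the walk. -/
def walkRound (β β' : ℝ) (y : Bool) : Prog Ω 4 (Bool × Bool) :=
  (measureMixed β' y).bind fun o => (measureProj β false).bind fun s => .ret (o, s)

theorem queriesLe_walkRound (β β' : ℝ) (y : Bool) :
    (walkRound β β' y : Prog Ω 4 (Bool × Bool)).QueriesLe 2 :=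
  .bind (N := 1) (M := 1) (queriesLe_measureMixed β' y) fun _ =>
    .bind (M := 0) (queriesLe_measureProj β false) fun _ => Prog.queriesLe_ret _ _

/-- With p the component of Qψ orthogonal to ψ, the amplitudes are read off from Qψ = rψ + p and Qp
= (1 - r)Qψ. -/
theorem sumBranches_walkRound (H : Ω → ℕ) (β β' : ℝ) (y : Bool) (t : ℕ) (s : Bool)
    (F : Bool × Bool → ℕ → State Ω 4 → ℝ) :
    sumBranches H (walkRound β β' y) t (walkState H β β' y s) F =
      ∑ o : Bool, ∑ s' : Bool, F (o, s') (t + 2)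
        ((walkAmp (acceptProb H β β' y) s o s' : ℂ) • walkState H β β' y s') := by
  have hc := clean_mixedProj H β' y (walkState H β β' y s)
  rw [walkRound, sumBranches_bind, sumBranches_measureMixed H β' y t (clean_walkState _ _ _ _ _)]
  simp only [sumBranches_bind]
  rw [sumBranches_measureProj H β false _ hc,
    sumBranches_measureProj H β false _ ((clean_walkState H β β' y s).sub hc)]
  simp only [sumBranches, Fintype.sum_bool]
  cases s
  · simp only [walkState, Bool.false_eq_true, if_false, if_true, map_sub, mixedProj_walkPerp,
      gibbsProj_walkPerp, map_smul, gibbsProj_mixedProj_gibbsInit, walkAmp]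
    congr 3
    all_goals
      try unfold walkPerp
      push_cast
      module
  · simp only [walkState, Bool.false_eq_true, if_false, if_true, map_sub, gibbsProj_gibbsInit,
      gibbsProj_mixedProj_gibbsInit, walkAmp]
    congr 3
    all_goals
      try unfold walkPerp
      push_cast
      module

/-- Conservation of norm over one round from ψ reads 1 = r² + (1 - r)² + 2‖p‖², which gives ‖p‖² =
r(1 - r) without expanding p. -/
theorem normSq_walkState (H : Ω → ℕ) (β β' : ℝ) (y s : Bool) :
    normSq (walkState H β β' y s) =
      if s then 1 else acceptProb H β β' y * (1 - acceptProb H β β' y) := by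
  have h := sumBranches_walkRound H β β' y 0 true fun _ _ φ => normSq φ
  have h1 : normSq (walkState H β β' y true) = 1 := by
    simp [walkState, normSq_gibbsInit]
  rw [sumBranches_normSq, h1] at h
  simp only [Fintype.sum_bool, normSq_smul, h1, walkAmp, Complex.norm_real, Real.norm_eq_abs,
    sq_abs] at h
  cases s
  · simp only [Bool.false_eq_true, if_false]
    linarith
  · simpa using h1

end Walk

/-! ### Amplitude estimation and moving by the walk. -/

section Subroutines

variable {Ω : Type u} [Fintype Ω] [DecidableEq Ω] [Nonempty Ω]

theorem prob_add_prob_not {d : ℕ} {α : Type} (H : Ω → ℕ) (p : Prog Ω d α) (φ : State Ω d)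
    (E : α → ℕ → State Ω d → Prop) :
    prob H p φ E + prob H p φ (fun a s φ' => ¬ E a s φ') = normSq φ := by
  classical
  rw [prob, prob, ← sumBranches_add, ← sumBranches_normSq H p 0 φ]
  congr 1
  ext a s φ'
  split_ifs <;> simp

theorem sumBranches_walkRound_smul (H : Ω → ℕ) (β β' : ℝ) (y : Bool) (t : ℕ) (s : Bool) (c : ℂ)
    (F : Bool × Bool → ℕ → State Ω 4 → ℝ) :
    sumBranches H (walkRound β β' y) t (c • walkState H β β' y s) F =
      ∑ o : Bool, ∑ s' : Bool, F (o, s') (t + 2)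
        ((c * walkAmp (acceptProb H β β' y) s o s') • walkState H β β' y s') := by
  rw [sumBranches_smul, sumBranches_walkRound]
  simp only [smul_smul]

/-! ### Amplitude estimation -/

/-- `N` rounds of the walk from the state labelled `s`; the agreements are added to `k`. -/
def walkSample (β β' : ℝ) : ℕ → Bool → ℕ → Prog Ω 4 (ℕ × Bool)
  | 0, s, k => .ret (k, s)
  | N + 1, s, k => (walkRound β β' true).bind fun o =>
      walkSample β β' N o.2 (if o.1 = s then k + 1 else k)

/-- At most `R` rounds of the walk, until the state labelled `true` is reached. -/
def walkRestore (β β' : ℝ) : ℕ → Bool → Prog Ω 4 Unit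
  | 0, _ => .ret ()
  | _ + 1, true => .ret ()
  | R + 1, false => (walkRound β β' true).bind fun o => walkRestore β β' R o.2

theorem queriesLe_walkSample (β β' : ℝ) (N : ℕ) (s : Bool) (k : ℕ) :
    (walkSample β β' N s k : Prog Ω 4 (ℕ × Bool)).QueriesLe (2 * N) := by
  induction N generalizing s k with
  | zero => exact Prog.queriesLe_ret _ _
  | succ N ih =>
    exact ((queriesLe_walkRound β β' true).bind fun _ => ih _ _).mono (by omega)

theorem queriesLe_walkRestore (β β' : ℝ) (R : ℕ) (s : Bool) :
    (walkRestore β β' R s : Prog Ω 4 Unit).QueriesLe (2 * R) := by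
  induction R generalizing s with
  | zero => exact Prog.queriesLe_ret _ _
  | succ R ih =>
    cases s
    · exact ((queriesLe_walkRound β β' true).bind fun _ => ih _).mono (by omega)
    · exact Prog.queriesLe_ret _ _

/-- The restoration bound holds only on multiples of the two walk states, so the comparison is
restricted to the states that actually occur. -/
theorem sumBranches_walkSample_mono (H : Ω → ℕ) (β β' : ℝ) {F G : ℕ × Bool → ℕ → State Ω 4 → ℝ}
    (h : ∀ (k : ℕ) (s : Bool) (t : ℕ) (c : ℂ), F (k, s) t (c • walkState H β β' true s) ≤
      G (k, s) t (c • walkState H β β' true s)) (N : ℕ) (s : Bool) (k t : ℕ) (c : ℂ) :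
    sumBranches H (walkSample β β' N s k) t (c • walkState H β β' true s) F ≤
      sumBranches H (walkSample β β' N s k) t (c • walkState H β β' true s) G := by
  induction N generalizing s k t c with
  | zero => exact h _ _ _ _
  | succ N ih =>
    simp only [walkSample, sumBranches_bind, sumBranches_walkRound_smul]
    exact Finset.sum_le_sum fun o _ => Finset.sum_le_sum fun s' _ => ih _ _ _ _

/-- From either walk state, an agreement has probability r. The number of agreements therefore has
exactly the binomial moment generating function, weighted by the initial norm. -/
theorem sumBranches_walkSample_exp (H : Ω → ℕ) (β β' l : ℝ) (N : ℕ) (s : Bool) (k t : ℕ)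
    (c : ℂ) :
    sumBranches H (walkSample β β' N s k) t (c • walkState H β β' true s)
        (fun a _ φ => Real.exp (l * a.1) * normSq φ) =
      Real.exp (l * k) * (acceptProb H β β' true * Real.exp l + (1 - acceptProb H β β' true)) ^ N *
        normSq (c • walkState H β β' true s) := by
  induction N generalizing s k t c with
  | zero => simp [walkSample, sumBranches]
  | succ N ih =>
    simp only [walkSample, sumBranches_bind, sumBranches_walkRound_smul, ih, Fintype.sum_bool,
      normSq_smul, normSq_walkState, norm_mul, mul_pow, Complex.norm_real, Real.norm_eq_abs, sq_abs]
    have h : Real.exp (l * ((k : ℝ) + 1)) = Real.exp l * Real.exp (l * k) := by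
      rw [← Real.exp_add]
      ring_nf
    cases s <;> simp [walkAmp, h] <;> ring

/-- After centering, e^x ≤ 1 + x + x² is applied to both values l(1 - r) and -lr. The linear terms
cancel and the quadratic ones add up to r(1 - r)l² ≤ l². -/
theorem bernoulli_mgf_le {r l : ℝ} (h0 : 0 ≤ r) (h1 : r ≤ 1) (hl : |l| ≤ 1) :
    r * Real.exp l + (1 - r) ≤ Real.exp (l * r + l ^ 2) := by
  have key : ∀ x : ℝ, |x| ≤ 1 → Real.exp x ≤ 1 + x + x ^ 2 := fun x hx => by
    have := (abs_le.1 (Real.abs_exp_sub_one_sub_id_le hx)).2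
    linarith
  have hx : |l * (1 - r)| ≤ 1 := by
    rw [abs_mul, abs_of_nonneg (sub_nonneg.2 h1)]
    exact mul_le_one₀ hl (sub_nonneg.2 h1) (by linarith)
  have hy : |-(l * r)| ≤ 1 := by
    rw [abs_neg, abs_mul, abs_of_nonneg h0]
    exact mul_le_one₀ hl h0 h1
  have e1 : Real.exp l = Real.exp (l * r) * Real.exp (l * (1 - r)) := by
    rw [← Real.exp_add]
    ring_nf
  have e2 : (1 : ℝ) = Real.exp (l * r) * Real.exp (-(l * r)) := by
    rw [← Real.exp_add, add_neg_cancel, Real.exp_zero]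
  have e3 : r * Real.exp l + (1 - r) =
      Real.exp (l * r) * (r * Real.exp (l * (1 - r)) + (1 - r) * Real.exp (-(l * r))) := by
    rw [e1]
    linear_combination (1 - r) * e2
  rw [e3, Real.exp_add]
  refine mul_le_mul_of_nonneg_left ?_ (Real.exp_pos _).le
  have h2 := mul_le_mul_of_nonneg_left (key _ hx) h0
  have h3 := mul_le_mul_of_nonneg_left (key _ hy) (sub_nonneg.2 h1)
  have h4 := Real.add_one_le_exp (l ^ 2)
  have h5 : r * (1 - r) ≤ 1 := by nlinarith
  nlinarith [mul_le_mul_of_nonneg_left h5 (sq_nonneg l)]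

theorem acceptProb_true_mem (H : Ω → ℕ) (β β' : ℝ) :
    4 / 9 ≤ acceptProb H β β' true ∧ acceptProb H β β' true ≤ 5 / 9 := by
  have h0 := overlap_nonneg H β β'
  have h1 := overlap_le_one H β β'
  simp only [acceptProb, if_true]
  constructor <;> linarith

/-- Two-sided Chernoff bound with exponents l = ±ε/2; the sum of the two exponential weights
dominates the indicator of the deviation. -/
theorem sumBranches_walkSample_deviation (H : Ω → ℕ) (β β' : ℝ) (N t : ℕ) {ε : ℝ} (h0 : 0 ≤ ε)
    (h1 : ε ≤ 1) {E : ℕ → Prop} [DecidablePred E]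
    (hE : ∀ k, E k → N * ε ≤ |k - N * acceptProb H β β' true|) :
    sumBranches H (walkSample β β' N true 0) t (gibbsInit H β)
        (fun a _ φ => if E a.1 then normSq φ else 0) ≤ 2 * Real.exp (-(N * ε ^ 2 / 4)) := by
  set r := acceptProb H β β' true with hr
  obtain ⟨hr0, hr1⟩ := acceptProb_true_mem H β β'
  rw [← hr] at hr0 hr1
  have hψ : gibbsInit H β = (1 : ℂ) • walkState H β β' true true := by simp [walkState]
  have hone : ∀ l : ℝ, |l| = ε / 2 →
      Real.exp (-(l * N * r) - N * ε ^ 2 / 2) * sumBranches H (walkSample β β' N true 0) t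
        (gibbsInit H β) (fun a _ φ => Real.exp (l * a.1) * normSq φ) ≤
      Real.exp (-(N * ε ^ 2 / 4)) := by
    intro l hl
    have hl2 : l ^ 2 = ε ^ 2 / 4 := by
      rw [← sq_abs, hl]
      ring
    rw [hψ, sumBranches_walkSample_exp, one_smul, normSq_walkState]
    simp only [if_true, mul_one, Nat.cast_zero, mul_zero, Real.exp_zero, one_mul]
    have hm := bernoulli_mgf_le (r := r) (l := l) (by linarith) (by linarith) (by linarith)
    have hm2 := pow_le_pow_left₀ (by
      have := Real.exp_pos l
      have : 0 ≤ r * Real.exp l := by positivity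
      linarith) hm N
    rw [← Real.exp_nat_mul] at hm2
    refine (mul_le_mul_of_nonneg_left hm2 (Real.exp_pos _).le).trans ?_
    rw [← Real.exp_add, hl2]
    refine le_of_eq ?_
    ring_nf
  have hp := hone (ε / 2) (abs_of_nonneg (by linarith))
  have hm := hone (-(ε / 2)) (by rw [abs_neg]; exact abs_of_nonneg (by linarith))
  rw [← sumBranches_const_mul] at hp hm
  have hle := sumBranches_mono H (walkSample β β' N true 0) t (gibbsInit H β)
    (F := fun a _ φ => if E a.1 then normSq φ else 0)
    (G := fun a _ φ => Real.exp (-(ε / 2 * N * r) - N * ε ^ 2 / 2) *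
        (Real.exp (ε / 2 * a.1) * normSq φ) + Real.exp (-(-(ε / 2) * N * r) - N * ε ^ 2 / 2) *
        (Real.exp (-(ε / 2) * a.1) * normSq φ)) fun a _ φ => by
      have hn := normSq_nonneg φ
      have e1 := Real.exp_pos (-(ε / 2 * N * r) - N * ε ^ 2 / 2)
      have e2 := Real.exp_pos (ε / 2 * a.1)
      have e3 := Real.exp_pos (-(-(ε / 2) * N * r) - N * ε ^ 2 / 2)
      have e4 := Real.exp_pos (-(ε / 2) * a.1)
      split_ifs with h
      · rw [← mul_assoc, ← mul_assoc, ← Real.exp_add, ← Real.exp_add, ← add_mul]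
        refine le_mul_of_one_le_left hn ?_
        rcases le_abs'.1 (hE _ h) with h | h
        · refine le_add_of_nonneg_of_le (Real.exp_pos _).le (Real.one_le_exp ?_)
          nlinarith
        · refine le_add_of_le_of_nonneg (Real.one_le_exp ?_) (Real.exp_pos _).le
          nlinarith
      · positivity
  rw [sumBranches_add] at hle
  linarith

open Classical in
-- From the orthogonal state a round misses ψ with probability r² + (1 - r)². The extra 4/9 in r
-- keeps r in [4/9, 5/9], so this is at most 16/81 + 25/81, whatever the overlap.
theorem sumBranches_walkRestore_le (H : Ω → ℕ) (β β' : ℝ) (R : ℕ) (s : Bool) (t : ℕ) (c : ℂ) :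
    sumBranches H (walkRestore β β' R s) t (c • walkState H β β' true s)
        (fun _ _ φ => if ¬ IsGibbs H β φ then normSq φ else 0) ≤
      (41 / 81) ^ R * normSq (c • walkState H β β' true s) := by
  have hg : ∀ c : ℂ, IsGibbs H β (c • walkState H β β' true true) := fun c =>
    ⟨c, by simp [walkState]⟩
  induction R generalizing s t c with
  | zero =>
    have := normSq_nonneg (c • walkState H β β' true s)
    simp only [walkRestore, sumBranches, pow_zero, one_mul]
    split_ifs <;> linarith
  | succ R ih =>
    cases s
    · simp only [walkRestore, sumBranches_bind, sumBranches_walkRound_smul, Fintype.sum_bool]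
      have h0 : ∀ t (c : ℂ), sumBranches H (walkRestore β β' R true) t
          (c • walkState H β β' true true)
          (fun _ _ φ => if ¬ IsGibbs H β φ then normSq φ else 0) = 0 := fun t c => by
        cases R <;> simp [walkRestore, sumBranches, hg]
      rw [h0, h0]
      refine (add_le_add (add_le_add le_rfl (ih _ _ _)) (add_le_add le_rfl (ih _ _ _))).trans ?_
      obtain ⟨h1, h2⟩ := acceptProb_true_mem H β β'
      simp only [normSq_smul, normSq_walkState, norm_mul, mul_pow, Complex.norm_real,
        Real.norm_eq_abs, sq_abs, walkAmp, Bool.false_eq_true, if_false]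
      set r := acceptProb H β β' true
      have h3 : (1 - r) ^ 2 + r ^ 2 ≤ 41 / 81 := by nlinarith
      have h4 : 0 ≤ (41 / 81 : ℝ) ^ R * (‖c‖ ^ 2 * (r * (1 - r))) := by
        have : 0 ≤ r * (1 - r) := mul_nonneg (by linarith) (by linarith)
        positivity
      have h5 := mul_le_mul_of_nonneg_left h3 h4
      rw [pow_succ (41 / 81 : ℝ) R]
      linarith
    · simp only [walkRestore, sumBranches, if_neg (not_not.2 (hg c))]
      exact mul_nonneg (by positivity) (normSq_nonneg _)

/-- The number of rounds of the walk used by amplitude estimation. -/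
def sampleRounds (η : ℝ) : ℕ := ⌈12960000 * Real.log (2 / η)⌉₊

/-- The number of rounds of the walk used for restoring the state. -/
def restoreRounds (η : ℝ) : ℕ := ⌈3 * Real.log (1 / η)⌉₊

/-- Non-destructive amplitude estimation. -/
def amplitudeEstimation (η β β' : ℝ) : Prog Ω 4 ℝ :=
  (walkSample β β' (sampleRounds η) true 0).bind fun a =>
    (walkRestore β β' (restoreRounds η) a.2).bind fun _ =>
      .ret (9 * ((a.1 : ℝ) / sampleRounds η) - 4)

theorem one_half_le_log_one_div {η : ℝ} (h0 : 0 < η) (h1 : η ≤ 1 / 2) :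
    1 / 2 ≤ Real.log (1 / η) := by
  have h2 : Real.log 2 ≤ Real.log (1 / η) :=
    Real.log_le_log (by norm_num) ((le_div_iff₀ h0).2 (by linarith))
  have := Real.log_two_gt_d9
  linarith

theorem amplitudeEstimation_accurate (H : Ω → ℕ) {η : ℝ} (β β' : ℝ) (h0 : 0 < η)
    (h1 : η ≤ 1 / 2) :
    1 - η ≤ prob H (amplitudeEstimation η β β') (gibbsInit H β)
      (fun p _ _ => |p - overlap H β β'| ≤ 0.005) := by
  classical
  have hc := prob_add_prob_not H (amplitudeEstimation η β β') (gibbsInit H β)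
    (fun p _ _ => |p - overlap H β β'| ≤ 0.005)
  rw [normSq_gibbsInit] at hc
  suffices h : prob H (amplitudeEstimation η β β') (gibbsInit H β)
      (fun p _ _ => ¬ |p - overlap H β β'| ≤ 0.005) ≤ η by linarith
  set N := sampleRounds η with hN
  have hL : 0 < Real.log (2 / η) := Real.log_pos ((one_lt_div h0).2 (by linarith))
  have hNL : 12960000 * Real.log (2 / η) ≤ N := Nat.le_ceil _
  have hNpos : (0 : ℝ) < N := by linarith
  -- The estimate is 9k/N - 4, so the tolerance 0.005 on the overlap is 0.005/9 = 1/1800 on r. The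
  -- number of rounds has the factor 4 · 1800² = 12960000.
  have hdev := sumBranches_walkSample_deviation H β β' N 0 (ε := 1 / 1800) (by norm_num)
    (by norm_num) (E := fun k => ¬ |9 * ((k : ℝ) / N) - 4 - overlap H β β'| ≤ 0.005) (by
      intro k hk
      have e : 9 * ((k : ℝ) / N) - 4 - overlap H β β' =
          (9 / N) * (k - N * acceptProb H β β' true) := by
        simp only [acceptProb, if_true]
        field_simp
        ring
      rw [e, abs_mul, abs_of_pos (by positivity), not_le, div_mul_eq_mul_div, lt_div_iff₀ hNpos]
        at hk
      norm_num at hk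
      linarith)
  refine le_trans (le_of_eq ?_) (hdev.trans ?_)
  · simp only [prob, amplitudeEstimation, sumBranches_bind]
    congr 1
    ext a t φ
    simp only [sumBranches]
    split_ifs with h
    · have := sumBranches_const_mul H (walkRestore β β' (restoreRounds η) a.2) t φ 0
        fun _ _ φ => normSq φ
      simpa using this
    · exact sumBranches_normSq H _ _ _
  · have e : Real.exp (-(N * (1 / 1800) ^ 2 / 4)) ≤ Real.exp (-Real.log (2 / η)) :=
      Real.exp_le_exp.2 (by linarith)
    rw [Real.exp_neg (Real.log _), Real.exp_log (by positivity), inv_div] at e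
    linarith

theorem amplitudeEstimation_restores (H : Ω → ℕ) {η : ℝ} (β β' : ℝ) (h0 : 0 < η) :
    1 - η ≤ prob H (amplitudeEstimation η β β') (gibbsInit H β)
      (fun _ _ φ => IsGibbs H β φ) := by
  classical
  have hc := prob_add_prob_not H (amplitudeEstimation η β β') (gibbsInit H β)
    (fun _ _ φ => IsGibbs H β φ)
  rw [normSq_gibbsInit] at hc
  suffices h : prob H (amplitudeEstimation η β β') (gibbsInit H β)
      (fun _ _ φ => ¬ IsGibbs H β φ) ≤ η by linarith
  have hψ : gibbsInit H β = (1 : ℂ) • walkState H β β' true true := by simp [walkState]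
  have hR : (41 / 81 : ℝ) ^ restoreRounds η ≤ η := by
    have e1 : (41 / 81 : ℝ) ≤ Real.exp (-(40 / 81)) := by
      have := Real.add_one_le_exp (-(40 / 81) : ℝ)
      linarith
    have e2 := pow_le_pow_left₀ (by norm_num) e1 (restoreRounds η)
    rw [← Real.exp_nat_mul] at e2
    refine e2.trans ?_
    have e3 : 3 * Real.log (1 / η) ≤ restoreRounds η := Nat.le_ceil _
    have e4 : (0 : ℝ) ≤ restoreRounds η := Nat.cast_nonneg _
    rw [one_div, Real.log_inv] at e3
    calc Real.exp _ ≤ Real.exp (Real.log η) := Real.exp_le_exp.2 (by linarith)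
      _ = η := Real.exp_log h0
  have hle := sumBranches_walkSample_mono H β β'
    (F := fun a t φ => sumBranches H (walkRestore β β' (restoreRounds η) a.2) t φ
      (fun _ _ φ => if ¬ IsGibbs H β φ then normSq φ else 0))
    (G := fun _ _ φ => η * normSq φ) (fun k s t c => by
      have h := sumBranches_walkRestore_le H β β' (restoreRounds η) s t c
      exact h.trans (mul_le_mul_of_nonneg_right hR (normSq_nonneg _)))
    (sampleRounds η) true 0 0 1
  rw [← hψ, sumBranches_const_mul, sumBranches_normSq, normSq_gibbsInit, mul_one] at hle
  refine le_trans (le_of_eq ?_) hle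
  simp only [prob, amplitudeEstimation, sumBranches_bind, sumBranches]
  congr!

theorem queriesLe_amplitudeEstimation (η β β' : ℝ) :
    (amplitudeEstimation η β β' : Prog Ω 4 ℝ).QueriesLe
      (2 * sampleRounds η + (2 * restoreRounds η + 0)) :=
  (queriesLe_walkSample β β' _ _ _).bind fun _ =>
    (queriesLe_walkRestore β β' _ _).bind fun _ => Prog.queriesLe_ret _ _

theorem sampleRounds_add_restoreRounds_le {η : ℝ} (h0 : 0 < η) (h1 : η ≤ 1 / 2) :
    ((2 * sampleRounds η + (2 * restoreRounds η + 0) : ℕ) : ℝ) ≤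
      60000000 * Real.log (1 / η) := by
  have hL := one_half_le_log_one_div h0 h1
  have h2 : Real.log (2 / η) = Real.log 2 + Real.log (1 / η) := by
    rw [← Real.log_mul (by norm_num) (by positivity), mul_one_div]
  have h3 : Real.log 2 ≤ Real.log (1 / η) :=
    Real.log_le_log (by norm_num) ((le_div_iff₀ h0).2 (by linarith))
  have h4 := Real.log_two_gt_d9
  have hN : (sampleRounds η : ℝ) < 12960000 * Real.log (2 / η) + 1 :=
    Nat.ceil_lt_add_one (by rw [h2]; nlinarith)
  have hR : (restoreRounds η : ℝ) < 3 * Real.log (1 / η) + 1 :=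
    Nat.ceil_lt_add_one (by linarith)
  push_cast
  linarith

/-! ### Moving between Gibbs states -/

/-- At most `R` rounds of the walk, until `|μ_β'⟩ ⊗ |0⟩` is reached. -/
def walkMove (β β' : ℝ) : ℕ → Prog Ω 4 Unit
  | 0 => .ret ()
  | R + 1 => (measureMixed β' false).bind fun o =>
      if o then .unitary mix (.ret ())
      else (measureProj β false).bind fun _ => walkMove β β' R

theorem queriesLe_walkMove (β β' : ℝ) (R : ℕ) :
    (walkMove β β' R : Prog Ω 4 Unit).QueriesLe (2 * R) := by
  induction R with
  | zero => exact Prog.queriesLe_ret _ _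
  | succ R ih =>
    refine ((queriesLe_measureMixed β' false).bind (M := 1 + 2 * R) fun o => ?_).mono (by omega)
    cases o
    · exact (queriesLe_measureProj β false).bind fun _ => ih
    · exact .unitary _ (Prog.queriesLe_ret _ _)

theorem isGibbs_mix_mulVec_mixedProj (H : Ω → ℕ) (β : ℝ) (φ : State Ω 4) :
    IsGibbs H β ((mix : Matrix.unitaryGroup (Ω × Fin 4) ℂ).1 *ᵥ mixedProj H β false φ) := by
  rw [mixedProj_apply, mix_mulVec_mix_mulVec, gibbsProj_false]
  exact ⟨_, rfl⟩

/-- Acceptance by Q stops the program in the target state, where `F` vanishes. Only the rejecting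
half of a walk round survives. -/
theorem sumBranches_walkMove_succ (H : Ω → ℕ) (β β' : ℝ) (R t : ℕ) (s : Bool) (c : ℂ)
    {F : Unit → ℕ → State Ω 4 → ℝ} (hF : ∀ t φ, IsGibbs H β' φ → F () t φ = 0) :
    sumBranches H (walkMove β β' (R + 1)) t (c • walkState H β β' false s) F =
      ∑ s' : Bool, sumBranches H (walkMove β β' R) (t + 2)
        ((c * walkAmp (acceptProb H β β' false) s false s') • walkState H β β' false s') F := by
  have h := sumBranches_walkRound_smul H β β' false t s c
    (fun o t φ => if o.1 then 0 else sumBranches H (walkMove β β' R) t φ F)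
  have hc := (clean_walkState H β β' false s).smul c
  simp only [Fintype.sum_bool, if_true, add_zero, zero_add, Bool.false_eq_true, if_false] at h
  rw [Fintype.sum_bool, ← h, walkMove, walkRound, sumBranches_bind, sumBranches_bind,
    sumBranches_measureMixed H β' false t hc, sumBranches_measureMixed H β' false t hc]
  simp only [if_true, Bool.false_eq_true, if_false, sumBranches, sumBranches_bind]
  rw [hF _ _ (isGibbs_mix_mulVec_mixedProj H β' _),
    sumBranches_measureProj H β false _ (clean_mixedProj H β' false _)]
  simp

open Classical in
-- Q rejects with probability 1 - r from ψ and r from the orthogonal state. Here r = overlap/9 lies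
-- in [1/135, 1/9], so both are at most 134/135.
theorem sumBranches_walkMove_le (H : Ω → ℕ) {β β' : ℝ} (h : 1 / 15 ≤ overlap H β β') (R t : ℕ)
    (s : Bool) (c : ℂ) :
    sumBranches H (walkMove β β' R) t (c • walkState H β β' false s)
        (fun _ _ φ => if ¬ IsGibbs H β' φ then normSq φ else 0) ≤
      (134 / 135) ^ R * normSq (c • walkState H β β' false s) := by
  induction R generalizing s t c with
  | zero =>
    have := normSq_nonneg (c • walkState H β β' false s)
    simp only [walkMove, sumBranches, pow_zero, one_mul]
    split_ifs <;> linarith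
  | succ R ih =>
    rw [sumBranches_walkMove_succ H β β' R t s c fun t φ hφ => if_neg (not_not.2 hφ)]
    refine (Finset.sum_le_sum fun s' _ => ih _ _ _).trans ?_
    have h1 : 1 / 135 ≤ acceptProb H β β' false := by
      simp only [acceptProb, Bool.false_eq_true, if_false]
      linarith
    have h2 : acceptProb H β β' false ≤ 1 / 9 := by
      have := overlap_le_one H β β'
      simp only [acceptProb, Bool.false_eq_true, if_false]
      linarith
    simp only [normSq_smul, normSq_walkState, norm_mul, mul_pow, Complex.norm_real,
      Real.norm_eq_abs, sq_abs, Fintype.sum_bool, if_true, Bool.false_eq_true, if_false]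
    set r := acceptProb H β β' false
    have hx : 0 ≤ (134 / 135 : ℝ) ^ R * ‖c‖ ^ 2 := by positivity
    rw [pow_succ (134 / 135 : ℝ) R]
    cases s
    · have h3 : 0 ≤ r * (1 - r) := mul_nonneg (by linarith) (by linarith)
      have h4 : r * (r * (1 - r)) ≤ 134 / 135 * (r * (1 - r)) :=
        mul_le_mul_of_nonneg_right (by linarith) h3
      have h5 := mul_le_mul_of_nonneg_left h4 hx
      simp only [walkAmp, Bool.false_eq_true, if_false]
      linarith
    · have h5 := mul_le_mul_of_nonneg_left (show 1 - r ≤ 134 / 135 by linarith) hx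
      simp only [walkAmp, if_true]
      linarith

/-- The number of rounds of the walk used for moving. -/
def moveRounds (η : ℝ) : ℕ := ⌈135 * Real.log (1 / η)⌉₊

theorem walkMove_correct (H : Ω → ℕ) {η β β' : ℝ} (h0 : 0 < η) (h : 1 / 15 ≤ overlap H β β') :
    1 - η ≤ prob H (walkMove β β' (moveRounds η)) (gibbsInit H β)
      (fun _ _ φ => IsGibbs H β' φ) := by
  classical
  have hc := prob_add_prob_not H (walkMove β β' (moveRounds η)) (gibbsInit H β)
    (fun _ _ φ => IsGibbs H β' φ)
  rw [normSq_gibbsInit] at hc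
  suffices h : prob H (walkMove β β' (moveRounds η)) (gibbsInit H β)
      (fun _ _ φ => ¬ IsGibbs H β' φ) ≤ η by linarith
  have hψ : gibbsInit H β = (1 : ℂ) • walkState H β β' false true := by simp [walkState]
  have hR : (134 / 135 : ℝ) ^ moveRounds η ≤ η := by
    have e1 : (134 / 135 : ℝ) ≤ Real.exp (-(1 / 135)) := by
      have := Real.add_one_le_exp (-(1 / 135) : ℝ)
      linarith
    have e2 := pow_le_pow_left₀ (by norm_num) e1 (moveRounds η)
    rw [← Real.exp_nat_mul] at e2
    refine e2.trans ?_
    have e3 : 135 * Real.log (1 / η) ≤ moveRounds η := Nat.le_ceil _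
    rw [one_div, Real.log_inv] at e3
    calc Real.exp _ ≤ Real.exp (Real.log η) := Real.exp_le_exp.2 (by linarith)
      _ = η := Real.exp_log h0
  have hle := sumBranches_walkMove_le H h (moveRounds η) 0 true 1
  rw [← hψ, normSq_gibbsInit, mul_one] at hle
  refine le_trans (le_of_eq ?_) (hle.trans hR)
  rw [prob]
  congr!

theorem moveRounds_le {η : ℝ} (h0 : 0 < η) (h1 : η ≤ 1 / 2) :
    ((2 * moveRounds η : ℕ) : ℝ) ≤ 60000000 * Real.log (1 / η) := by
  have hL := one_half_le_log_one_div h0 h1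
  have hR : (moveRounds η : ℝ) < 135 * Real.log (1 / η) + 1 :=
    Nat.ceil_lt_add_one (by linarith)
  push_cast
  linarith

/-- Amplitude estimation and moving by walks between two projections. -/
def walkSubroutines (Ω : Type u) [Fintype Ω] [DecidableEq Ω] [Nonempty Ω] : Subroutines Ω 4 where
  estimate := amplitudeEstimation
  move η β β' := walkMove β β' (moveRounds η)

theorem walkSubroutines_estimateCorrect (H : Ω → ℕ) :
    (walkSubroutines Ω).EstimateCorrect 60000000 H := fun _ β β' h0 h1 _ _ =>
  ⟨amplitudeEstimation_accurate H β β' h0 h1, amplitudeEstimation_restores H β β' h0, _,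
    sampleRounds_add_restoreRounds_le h0 h1, queriesLe_amplitudeEstimation _ β β'⟩

theorem walkSubroutines_moveCorrect (H : Ω → ℕ) :
    (walkSubroutines Ω).MoveCorrect 60000000 H := fun _ β β' h0 h1 _ _ =>
  ⟨walkMove_correct H h0, _, moveRounds_le h0 h1, queriesLe_walkMove β β' _⟩

end Subroutines

/-! ### Convexity of ln Z and the number of long steps. -/

section Thermodynamics

variable {Ω : Type u} [Fintype Ω] [DecidableEq Ω] [Nonempty Ω]

/-! ## The logarithm of the partition function -/

/-- The logarithm of the partition function. -/
def logZ (H : Ω → ℕ) (β : ℝ) : ℝ := Real.log (Z H β)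

/-- The expectation of the Hamiltonian in the Gibbs distribution, which is minus the derivative of
`logZ`. -/
def meanEnergy (H : Ω → ℕ) (β : ℝ) : ℝ := ∑ x, gibbs H β x * H x

/-- The second difference of `logZ` on `[a, b]`. -/
def convexityGap (H : Ω → ℕ) (a b : ℝ) : ℝ := logZ H a + logZ H b - 2 * logZ H ((a + b) / 2)

theorem exp_logZ (H : Ω → ℕ) (β : ℝ) : Real.exp (logZ H β) = Z H β := Real.exp_log (Z_pos H β)

/-- The amplitude ⟨μ_a|μ_b⟩ equals Z((a+b)/2)/√(Z(a)Z(b)). -/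
theorem overlap_eq_exp (H : Ω → ℕ) (a b : ℝ) : overlap H a b = Real.exp (-convexityGap H a b) := by
  have h : qsample H a ⬝ᵥ qsample H b =
      ((∑ x, Real.sqrt (gibbs H a x) * Real.sqrt (gibbs H b x) : ℝ) : ℂ) := by
    simp [dotProduct, qsample]
  have h2 : ∀ x, Real.sqrt (gibbs H a x) * Real.sqrt (gibbs H b x) =
      Real.exp (-((logZ H a + logZ H b) / 2)) * Real.exp (-((a + b) / 2) * (H x : ℝ)) := by
    intro x
    have h3 : ∀ β, Real.sqrt (gibbs H β x) = Real.exp ((-β * H x - logZ H β) / 2) := by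
      intro β
      rw [gibbs, ← exp_logZ, ← Real.exp_sub, Real.exp_half]
    rw [h3, h3, ← Real.exp_add, ← Real.exp_add]
    ring_nf
  rw [overlap, star_qsample, h, Complex.norm_real, Real.norm_eq_abs, sq_abs]
  simp only [h2]
  rw [← Finset.mul_sum]
  change (_ * Z H ((a + b) / 2)) ^ 2 = _
  rw [← exp_logZ, ← Real.exp_add, ← Real.exp_nat_mul, convexityGap]
  push_cast
  ring_nf

theorem ratio_eq_exp (H : Ω → ℕ) (a b : ℝ) :
    Z H a * Z H b / Z H ((a + b) / 2) ^ 2 = Real.exp (convexityGap H a b) := by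
  rw [← exp_logZ, ← exp_logZ, ← exp_logZ, ← Real.exp_nat_mul, ← Real.exp_add, ← Real.exp_sub,
    convexityGap]
  push_cast
  rfl

theorem meanEnergy_nonneg (H : Ω → ℕ) (β : ℝ) : 0 ≤ meanEnergy H β :=
  Finset.sum_nonneg fun x _ => mul_nonneg (gibbs_pos H β x).le (Nat.cast_nonneg _)

theorem meanEnergy_le {H : Ω → ℕ} {n : ℕ} (hH : ∀ x, H x ≤ n) (β : ℝ) : meanEnergy H β ≤ n := by
  calc meanEnergy H β ≤ ∑ x, gibbs H β x * n :=
        Finset.sum_le_sum fun x _ =>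
          mul_le_mul_of_nonneg_left (by exact_mod_cast hH x) (gibbs_pos H β x).le
    _ = n := by rw [← Finset.sum_mul, sum_gibbs, one_mul]

/-- The graph of `logZ` lies above its tangents. -/
theorem logZ_tangent (H : Ω → ℕ) (a m : ℝ) :
    logZ H a - meanEnergy H a * (m - a) ≤ logZ H m := by
  rw [logZ, logZ, Real.le_log_iff_exp_le (Z_pos H m), Real.exp_sub, Real.exp_log (Z_pos H a)]
  set c := meanEnergy H a * (m - a) with hc
  have h1 : ∀ x, Real.exp (-c) * Real.exp (-a * H x) * (1 - (m - a) * H x + c) ≤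
      Real.exp (-m * H x) := by
    intro x
    have h2 := Real.add_one_le_exp (-(m - a) * H x + c)
    have h3 : Real.exp (-m * H x) =
        Real.exp (-c) * Real.exp (-a * H x) * Real.exp (-(m - a) * H x + c) := by
      rw [← Real.exp_add, ← Real.exp_add]
      ring_nf
    rw [h3]
    exact mul_le_mul_of_nonneg_left (by linarith) (by positivity)
  have h4 : ∑ x, Real.exp (-a * H x) * (H x : ℝ) = meanEnergy H a * Z H a := by
    rw [meanEnergy, Finset.sum_mul]
    refine Finset.sum_congr rfl fun x _ => ?_
    rw [gibbs]
    have := (Z_pos H a).ne'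
    field_simp
  have h5 := Finset.sum_le_sum fun x (_ : x ∈ Finset.univ) => h1 x
  have h6 : ∑ x, Real.exp (-c) * Real.exp (-a * H x) * (1 - (m - a) * H x + c) =
      Real.exp (-c) * ((1 + c) * ∑ x, Real.exp (-a * H x) -
        (m - a) * ∑ x, Real.exp (-a * H x) * (H x : ℝ)) := by
    rw [Finset.mul_sum, Finset.mul_sum, ← Finset.sum_sub_distrib, Finset.mul_sum]
    exact Finset.sum_congr rfl fun x _ => by ring
  rw [h6, h4] at h5
  change Real.exp (-c) * ((1 + c) * Z H a - _) ≤ Z H m at h5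
  rw [div_eq_mul_inv, ← Real.exp_neg]
  have h7 : (1 + c) * Z H a - (m - a) * (meanEnergy H a * Z H a) = Z H a := by
    rw [hc]
    ring
  rw [h7] at h5
  linarith

theorem logZ_antitone (H : Ω → ℕ) : Antitone (logZ H) := fun a b hab => by
  have h1 := logZ_tangent H b a
  have h2 := mul_nonneg (meanEnergy_nonneg H b) (sub_nonneg.2 hab)
  linarith

theorem convexOn_logZ (H : Ω → ℕ) : ConvexOn ℝ Set.univ (logZ H) := by
  refine ⟨convex_univ, fun x _ y _ s t hs ht hst => ?_⟩
  simp only [smul_eq_mul]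
  have h1 := mul_le_mul_of_nonneg_left (logZ_tangent H (s * x + t * y) x) hs
  have h2 := mul_le_mul_of_nonneg_left (logZ_tangent H (s * x + t * y) y) ht
  obtain rfl : t = 1 - s := by linarith
  linarith

theorem convexityGap_self (H : Ω → ℕ) (a : ℝ) : convexityGap H a a = 0 := by
  rw [convexityGap, add_self_div_two]
  ring

/-- When b moves to b', the midpoint moves half as far, and it does so further to the left, where
secant slopes of a convex function are smaller. -/
theorem convexityGap_mono (H : Ω → ℕ) {a b b' : ℝ} (hab : a ≤ b) (hb : b ≤ b') :
    convexityGap H a b ≤ convexityGap H a b' := by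
  rcases hb.eq_or_lt with rfl | hb
  · rfl
  have hc := convexOn_logZ H
  have h1 : (logZ H ((a + b') / 2) - logZ H ((a + b) / 2)) / ((a + b') / 2 - (a + b) / 2) ≤
      (logZ H b' - logZ H ((a + b) / 2)) / (b' - (a + b) / 2) :=
    hc.secant_mono trivial trivial trivial (by linarith) (by linarith) (by linarith)
  have h2 : (logZ H ((a + b) / 2) - logZ H b') / ((a + b) / 2 - b') ≤
      (logZ H b - logZ H b') / (b - b') :=
    hc.secant_mono trivial trivial trivial (by linarith) (by linarith) (by linarith)
  rw [← neg_sub (logZ H b'), ← neg_sub b', neg_div_neg_eq, ← neg_sub (logZ H b') (logZ H b),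
    ← neg_sub b' b, neg_div_neg_eq] at h2
  have h3 := h1.trans h2
  rw [div_le_div_iff₀ (by linarith) (by linarith)] at h3
  have h4 : (logZ H ((a + b') / 2) - logZ H ((a + b) / 2)) ≤ (logZ H b' - logZ H b) / 2 := by
    have h5 : 0 < b' - b := by linarith
    refine le_of_mul_le_mul_right ?_ h5
    linarith
  simp only [convexityGap]
  linarith

/-- The endpoint term decreases, and twice the midpoint term loses at most 2 · n(b' - b)/2, because
ln Z has slope at least -n. -/
theorem convexityGap_le_add {H : Ω → ℕ} {n : ℕ} (hH : ∀ x, H x ≤ n) (a : ℝ) {b b' : ℝ}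
    (hb : b ≤ b') : convexityGap H a b' ≤ convexityGap H a b + n * (b' - b) := by
  have h1 := logZ_antitone H hb
  have h2 := logZ_tangent H ((a + b) / 2) ((a + b') / 2)
  have h3 := mul_le_mul_of_nonneg_right (meanEnergy_le hH ((a + b) / 2)) (sub_nonneg.2 hb)
  simp only [convexityGap]
  linarith

theorem logZ_zero (H : Ω → ℕ) : logZ H 0 = Real.log (Fintype.card Ω) := by
  simp [logZ, Z]

theorem logZ_nonneg {H : Ω → ℕ} (h : ∃ x, H x = 0) (β : ℝ) : 0 ≤ logZ H β := by
  obtain ⟨x, hx⟩ := h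
  refine Real.log_nonneg ?_
  calc (1 : ℝ) = Real.exp (-β * H x) := by simp [hx]
    _ ≤ Z H β := Finset.single_le_sum (f := fun x => Real.exp (-β * (H x : ℝ)))
        (fun _ _ => (Real.exp_pos _).le) (Finset.mem_univ x)

/-! ### Long steps

A step from `a` to `b` is long if the second difference of `logZ` is at least `2`. -/

theorem two_le_logZ_sub {H : Ω → ℕ} {a b : ℝ} (h : 2 ≤ convexityGap H a b) :
    2 + meanEnergy H b * (b - a) ≤ logZ H a - logZ H b := by
  have h1 := logZ_tangent H b ((a + b) / 2)
  simp only [convexityGap] at h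
  linarith

/-- Z more than halves over the step, while configurations of energy 0 keep their weight. Hence they
have probability at most 1/2 at a, and 1 - E(a) is at most that probability. -/
theorem one_half_le_meanEnergy {H : Ω → ℕ} {a b : ℝ} (hab : a ≤ b)
    (h : 2 ≤ convexityGap H a b) : 1 / 2 ≤ meanEnergy H a := by
  have h1 := two_le_logZ_sub h
  have h2 := mul_nonneg (meanEnergy_nonneg H b) (sub_nonneg.2 hab)
  have h3 : Z H b ≤ Z H a * (1 / 2) := by
    rw [← exp_logZ, ← exp_logZ]
    have h4 : Real.exp (logZ H b) ≤ Real.exp (logZ H a - 1) := Real.exp_le_exp.2 (by linarith)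
    rw [Real.exp_sub, div_eq_mul_one_div] at h4
    refine h4.trans (mul_le_mul_of_nonneg_left ?_ (Real.exp_pos _).le)
    have h5 := Real.exp_one_gt_d9
    exact one_div_le_one_div_of_le (by norm_num) (by linarith)
  have h4 : Z H a * (1 - meanEnergy H a) ≤ Z H b := by
    have h5 : Z H a * (1 - meanEnergy H a) = ∑ x, Real.exp (-a * H x) * (1 - (H x : ℝ)) := by
      rw [mul_sub, mul_one, meanEnergy, Finset.mul_sum, Z, ← Finset.sum_sub_distrib]
      refine Finset.sum_congr rfl fun x _ => ?_
      rw [gibbs]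
      have h6 := (Z_pos H a).ne'
      rw [Z] at h6
      rw [Z]
      field_simp
    rw [h5]
    refine Finset.sum_le_sum fun x _ => ?_
    rcases Nat.eq_zero_or_pos (H x) with hx | hx
    · simp [hx]
    · have hx1 : (1 : ℝ) ≤ H x := by exact_mod_cast hx
      exact (mul_nonpos_of_nonneg_of_nonpos (Real.exp_pos _).le (by linarith)).trans
        (Real.exp_pos _).le
  have h5 := Z_pos H a
  by_contra! h6
  nlinarith

theorem meanEnergy_pos {H : Ω → ℕ} {a : ℝ} (h : 0 < meanEnergy H a) (b : ℝ) :
    0 < meanEnergy H b := by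
  obtain ⟨x, hx⟩ : ∃ x, 0 < H x := by
    by_contra! h1
    have h2 : meanEnergy H a = 0 := Finset.sum_eq_zero fun x _ => by
      simp [Nat.le_zero.1 (h1 x)]
    linarith
  have h3 : (0 : ℝ) < H x := by exact_mod_cast hx
  exact Finset.sum_pos' (fun y _ => mul_nonneg (gibbs_pos H b y).le (Nat.cast_nonneg _))
    ⟨x, Finset.mem_univ x, mul_pos (gibbs_pos H b x) h3⟩

/-- Put x = E(a), y = E(b), s = b - a. The tangents at the midpoint give D ≥ 2 + ys for the drop D
of ln Z, and (x - y)s ≥ 4. Hence D(x - y)s ≥ 2(x - y)s + 4ys = 2(x + y)s, and ln(x/y) ≥ 2(x - y)/(x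
+ y) finishes the proof. -/
theorem four_le_logZ_sub_mul_log {H : Ω → ℕ} {a b : ℝ} (hab : a ≤ b)
    (h : 2 ≤ convexityGap H a b) : 4 ≤ (logZ H a - logZ H b) *
      (Real.log (meanEnergy H a) - Real.log (meanEnergy H b)) := by
  have hx : 0 < meanEnergy H a := by linarith [one_half_le_meanEnergy hab h]
  have hy : 0 < meanEnergy H b := meanEnergy_pos hx b
  have hD := two_le_logZ_sub h
  have hX : 4 + meanEnergy H b * (b - a) ≤ meanEnergy H a * (b - a) := by
    have h1 := logZ_tangent H b ((a + b) / 2)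
    have h2 := logZ_tangent H a ((a + b) / 2)
    simp only [convexityGap] at h
    linarith
  have hs : 0 < b - a := by
    rcases hab.eq_or_lt with rfl | hab
    · rw [convexityGap_self] at h
      linarith
    · linarith
  set x := meanEnergy H a
  set y := meanEnergy H b
  set D := logZ H a - logZ H b
  have hxy : y < x := by
    by_contra! hxy
    nlinarith
  have h3 : 2 * (x - y) / (x + y) ≤ Real.log x - Real.log y := by
    rw [← Real.log_div hx.ne' hy.ne']
    have h4 := Real.le_log_one_add_of_nonneg (x := x / y - 1)
      (by rw [sub_nonneg, one_le_div hy]; exact hxy.le)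
    rw [add_sub_cancel] at h4
    refine le_trans (le_of_eq ?_) h4
    have h5 : x / y - 1 + 2 = (x + y) / y := by
      field_simp
      ring
    have h6 : x + y ≠ 0 := (add_pos hx hy).ne'
    rw [h5]
    field_simp
  have h5 : 0 < D := by nlinarith [mul_pos hy hs]
  refine le_trans ?_ (mul_le_mul_of_nonneg_left h3 h5.le)
  rw [← mul_div_assoc, le_div_iff₀ (by linarith)]
  have h6 : 2 * (x + y) * (b - a) ≤ D * (x - y) * (b - a) := by
    have h7 : 0 < y * (b - a) := mul_pos hy hs
    have h8 : 0 ≤ (x - y) * (b - a) := mul_nonneg (by linarith) hs.le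
    nlinarith [mul_le_mul_of_nonneg_right hD h8]
  have h9 := le_of_mul_le_mul_right h6 hs
  linarith

/-- One step of Cauchy–Schwarz: by AM-GM the cross terms are at least 2√(DL · dl) ≥ 8k. -/
theorem four_mul_succ_sq_le {k D L d l : ℝ} (hD : 0 ≤ D) (hL : 0 ≤ L) (hd : 0 ≤ d)
    (hl : 0 ≤ l) (h : 4 * k ^ 2 ≤ D * L) (h' : 4 ≤ d * l) :
    4 * (k + 1) ^ 2 ≤ (D + d) * (L + l) := by
  have h1 : 8 * k ≤ D * l + d * L := by
    refine abs_le_of_sq_le_sq' ?_ (by positivity) |>.2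
    have h2 : 4 * k ^ 2 * 4 ≤ D * L * (d * l) := mul_le_mul h h' (by norm_num) (by positivity)
    nlinarith [sq_nonneg (D * l - d * L)]
  have h2 : 0 ≤ D * l + d * L := by positivity
  nlinarith

/-- `k` long steps lead from `β₀` to `β`, as far as the second differences of `logZ` can tell. -/
structure LongSteps (H : Ω → ℕ) (β₀ : ℝ) (k : ℕ) (β : ℝ) : Prop where
  logZ_sub : 2 * k ≤ logZ H β₀ - logZ H β
  log_sub : 0 ≤ Real.log (meanEnergy H β₀) - Real.log (meanEnergy H β)
  mul : 4 * (k : ℝ) ^ 2 ≤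
    (logZ H β₀ - logZ H β) * (Real.log (meanEnergy H β₀) - Real.log (meanEnergy H β))

theorem LongSteps.zero (H : Ω → ℕ) (β₀ : ℝ) : LongSteps H β₀ 0 β₀ := by
  constructor <;> simp

theorem LongSteps.succ {H : Ω → ℕ} {β₀ a b : ℝ} {k : ℕ} (hs : LongSteps H β₀ k a)
    (hab : a ≤ b) (h : 2 ≤ convexityGap H a b) : LongSteps H β₀ (k + 1) b := by
  have h1 := two_le_logZ_sub h
  have h2 := mul_nonneg (meanEnergy_nonneg H b) (sub_nonneg.2 hab)
  have h3 := four_le_logZ_sub_mul_log hab h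
  have h4 : 0 ≤ Real.log (meanEnergy H a) - Real.log (meanEnergy H b) := by
    by_contra! h5
    nlinarith
  have h6 := hs.logZ_sub
  have h7 := hs.log_sub
  refine ⟨by push_cast; linarith, by linarith, ?_⟩
  have h8 := four_mul_succ_sq_le (by linarith) h7 (by linarith) h4 hs.mul h3
  push_cast
  refine h8.trans (le_of_eq ?_)
  ring

/-- For n ≥ 10, ℓ ≥ 2.3 gives ln 2 ≤ 0.3014ℓ; the cases k = 0, 1 use only the lower bounds on q, and
k = 2 needs the -2 in q - 2. If qℓ ≥ 36, then k ≤ 4 is immediate and ln 2 ≤ 0.6932ℓ suffices from k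
= 5 on. -/
theorem succ_succ_sq_le {q ℓ : ℝ} {n k : ℕ} (hℓ : ℓ = Real.log n) (hℓ1 : 1 ≤ ℓ)
    (hq1 : 1 ≤ Real.log q) (hn : 10 ≤ n ∨ 36 ≤ q * ℓ) (h2 : 2 * ((k : ℝ) + 1) ≤ q)
    (h4 : 4 * (k : ℝ) ^ 2 ≤ (q - 2) * (ℓ + Real.log 2)) : ((k : ℝ) + 2) ^ 2 ≤ q * ℓ := by
  have hk : (0 : ℝ) ≤ k := Nat.cast_nonneg k
  have hl2 := Real.log_two_lt_d9
  have hq : 2.718 ≤ q := by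
    have h5 := Real.exp_one_gt_d9
    have h6 := (Real.le_log_iff_exp_le (by linarith)).1 hq1
    linarith
  by_contra! hlt
  rcases hn with hn | hn
  · have hℓ2 : 2.3 ≤ ℓ := by
      rw [hℓ, Real.le_log_iff_exp_le (by positivity)]
      have h5 : Real.exp 2.3 ≤ 10 := by
        have h6 : Real.exp 2.3 ^ 10 = Real.exp 1 ^ 23 := by
          rw [← Real.exp_nat_mul, ← Real.exp_nat_mul]
          norm_num
        have h7 := Real.exp_one_lt_d9
        have h8 : Real.exp 1 ^ 23 ≤ 10 ^ 10 :=
          (pow_le_pow_left₀ (Real.exp_pos _).le h7.le 23).trans (by norm_num)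
        rw [← h6] at h8
        exact le_of_pow_le_pow_left₀ (by norm_num) (by norm_num) h8
      exact h5.trans (by exact_mod_cast hn)
    rcases Nat.lt_or_ge k 2 with hk2 | hk2
    · interval_cases k
      · norm_num at hlt
        nlinarith
      · norm_num at hlt h2
        nlinarith
    · have hk3 : (2 : ℝ) ≤ k := by exact_mod_cast hk2
      have h5 : (q - 2) * (ℓ + Real.log 2) ≤ (q - 2) * (1.3014 * ℓ) :=
        mul_le_mul_of_nonneg_left (by linarith) (by linarith)
      nlinarith
  · have hk5 : 5 ≤ k := by
      by_contra! h5
      have h6 : (k : ℝ) ≤ 4 := by exact_mod_cast Nat.lt_succ_iff.1 h5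
      nlinarith
    have hk6 : (5 : ℝ) ≤ k := by exact_mod_cast hk5
    have h5 : (q - 2) * (ℓ + Real.log 2) ≤ (q - 2) * (1.6932 * ℓ) :=
      mul_le_mul_of_nonneg_left (by linarith) (by linarith)
    nlinarith

/-- The number of long steps is small compared to `√(q ln n)`. -/
theorem LongSteps.add_two_le {H : Ω → ℕ} {β₀ a b q : ℝ} {n k : ℕ} (hs : LongSteps H β₀ k a)
    (hab : a ≤ b) (h : 2 ≤ convexityGap H a b) (hq : q = Real.log (Fintype.card Ω))
    (hn1 : 1 ≤ Real.log n) (hq1 : 1 ≤ Real.log q) (hn : 10 ≤ n ∨ 36 ≤ q * Real.log n)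
    (hβ₀ : 0 ≤ β₀) (hH : ∀ x, H x ≤ n) (h0 : ∃ x, H x = 0) :
    (k : ℝ) + 2 ≤ Real.sqrt (q * Real.log n) := by
  have h1 : logZ H β₀ ≤ q := by
    rw [hq, ← logZ_zero H]
    exact logZ_antitone H hβ₀
  have h2 := logZ_nonneg h0 b
  have h3 := two_le_logZ_sub h
  have h4 := mul_nonneg (meanEnergy_nonneg H b) (sub_nonneg.2 hab)
  have h5 := one_half_le_meanEnergy hab h
  have h6 : 0 < meanEnergy H β₀ := meanEnergy_pos (a := a) (by linarith) β₀
  have h7 : Real.log (meanEnergy H β₀) ≤ Real.log n := Real.log_le_log h6 (meanEnergy_le hH β₀)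
  have h8 : -Real.log 2 ≤ Real.log (meanEnergy H a) := by
    rw [← Real.log_inv, ← one_div]
    exact Real.log_le_log (by norm_num) h5
  have h9 := hs.logZ_sub
  refine Real.le_sqrt_of_sq_le (succ_succ_sq_le rfl hn1 hq1 hn (by linarith) ?_)
  have h10 : (0 : ℝ) ≤ k := Nat.cast_nonneg k
  exact hs.mul.trans (mul_le_mul (by linarith) (by linarith) hs.log_sub (by linarith))

end Thermodynamics

/-! ### Correctness of binary search and of the main loop. -/

section Schedule

variable {Ω : Type u} [Fintype Ω] [DecidableEq Ω] [Nonempty Ω] {d : ℕ} [NeZero d]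

theorem IsGibbs.smul {H : Ω → ℕ} {β : ℝ} {φ : State Ω d} (h : IsGibbs H β φ) (c : ℂ) :
    IsGibbs H β (c • φ) := by
  obtain ⟨z, rfl⟩ := h
  exact ⟨c * z, smul_smul _ _ _⟩

theorem isGibbs_gibbsInit (H : Ω → ℕ) (β : ℝ) : IsGibbs H β (gibbsInit H β : State Ω d) :=
  ⟨1, (one_smul _ _).symm⟩

theorem prob_pure {α : Type} (H : Ω → ℕ) (a : α) (β : ℝ) {E : α → ℕ → State Ω d → Prop}
    (hE : E a 0 (gibbsInit H β)) :
    prob H (pure a) (gibbsInit H β) E = 1 := by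
  classical
  change (if E a 0 (gibbsInit H β) then normSq (gibbsInit H β) else 0) = 1
  rw [if_pos hE, normSq_gibbsInit]

/-! ### Binary search -/

/-- What the outcome of the test of `β'` tells about the overlap. -/
def TestSound (H : Ω → ℕ) (β β' : ℝ) (b : Bool) : Prop :=
  if b then 0.07 ≤ overlap H β β' else overlap H β β' ≤ 0.08

/-- What the outcome `β'` of the binary search satisfies. -/
structure SearchSound (H : Ω → ℕ) (q β β' : ℝ) : Prop where
  le : β ≤ β'
  le_right : β' ≤ q
  overlap : 0.07 ≤ overlap H β β'
  long : β' = q ∨ 2 ≤ convexityGap H β β'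

theorem overlapTest_correct {S : Subroutines Ω d} {C : ℝ} {H : Ω → ℕ}
    (hS : S.EstimateCorrect C H) {η β β' : ℝ} (h0 : 0 < η) (h1 : η ≤ 1 / 2) (hβ : 0 ≤ β)
    (hβ' : 0 ≤ β') :
    1 - 2 * η ≤ prob H (overlapTest S η β β') (gibbsInit H β)
        (fun b _ φ => TestSound H β β' b ∧ IsGibbs H β φ) ∧
      (overlapTest S η β β').QueriesLe ⌊C * Real.log (1 / η)⌋₊ := by
  obtain ⟨hacc, hres, N, hN, hq⟩ := hS η β β' h0 h1 hβ hβ'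
  refine ⟨?_, ?_⟩
  · have h := prob_bind (g := fun p => (pure (@decide (0.075 ≤ p) (Classical.propDecidable _)) :
        Prog Ω d Bool)) H (ε := η + η) (ε' := 0) le_rfl (by linarith)
      (A := fun p => |p - overlap H β β'| ≤ 0.005) (β' := fun _ => β)
      (E := fun b _ φ => TestSound H β β' b ∧ IsGibbs H β φ)
      (fun b s φ c h => ⟨h.1, h.2.smul c⟩) hq
      (prob_and H (normSq_gibbsInit H β) hacc hres) (fun p hp s hs => by
        rw [prob_pure, sub_zero]
        refine ⟨?_, isGibbs_gibbsInit H β⟩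
        have hp' := abs_le.1 hp
        unfold TestSound
        split_ifs with h
        · have := of_decide_eq_true h
          linarith
        · have : ¬ 0.075 ≤ p := fun h' => h (decide_eq_true h')
          linarith)
    refine le_trans (le_of_eq ?_) h
    ring
  · exact (hq.mono (Nat.le_floor hN)).bind (M := 0) fun _ => Prog.queriesLe_ret _ _

theorem five_halves_le_convexityGap {H : Ω → ℕ} {a b : ℝ} (h : overlap H a b ≤ 0.08) :
    5 / 2 ≤ convexityGap H a b := by
  rw [overlap_eq_exp] at h
  have h1 : (0.08 : ℝ) ≤ Real.exp (-(5 / 2)) := by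
    have h2 : Real.exp (5 / 2) ^ 2 = Real.exp 1 ^ 5 := by
      rw [← Real.exp_nat_mul, ← Real.exp_nat_mul]
      norm_num
    have h3 : Real.exp 1 ^ 5 ≤ 12.5 ^ 2 :=
      (pow_le_pow_left₀ (Real.exp_pos _).le Real.exp_one_lt_d9.le 5).trans (by norm_num)
    rw [← h2] at h3
    have h4 := le_of_pow_le_pow_left₀ two_ne_zero (by norm_num) h3
    rw [Real.exp_neg, le_inv_comm₀ (by norm_num) (Real.exp_pos _)]
    exact h4.trans (by norm_num)
  have h2 := Real.exp_le_exp.1 (h.trans h1)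
  linarith

theorem convexityGap_le_log_fifteen {H : Ω → ℕ} {a b : ℝ} (h : 0.07 ≤ overlap H a b) :
    convexityGap H a b ≤ Real.log 15 := by
  rw [overlap_eq_exp, Real.exp_neg, le_inv_comm₀ (by norm_num) (Real.exp_pos _)] at h
  exact (Real.le_log_iff_exp_le (by norm_num)).2 (h.trans (by norm_num))

theorem queriesLe_binarySearchLoop {test : ℝ → Prog Ω d Bool} {N : ℕ} {a b : ℝ}
    (hq : ∀ x, a ≤ x → x ≤ b → (test x).QueriesLe N) (prec : ℝ) (M : ℕ) {lo hi : ℝ} (hlo : a ≤ lo)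
    (hlh : lo ≤ hi) (hhi : hi ≤ b) : (binarySearchLoop test prec M lo hi).QueriesLe (M * N) := by
  induction M generalizing lo hi with
  | zero => exact Prog.queriesLe_ret _ _
  | succ M ih =>
    rw [binarySearchLoop]
    split_ifs
    · refine ((hq ((lo + hi) / 2) (by linarith) (by linarith)).bind (M := M * N) fun t => ?_).mono
        (by rw [Nat.succ_mul, add_comm])
      split_ifs
      · exact ih (by linarith) (by linarith) hhi
      · exact ih hlo (by linarith) (by linarith)
    · exact Prog.queriesLe_ret _ _

/-- Noisy tests need not be monotone or consistent. Only the invariant matters: overlap at least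
0.07 at `lo` and at most 0.08 at `hi`. -/
theorem binarySearchLoop_correct {H : Ω → ℕ} {n : ℕ} (hn : 0 < n) (hH : ∀ x, H x ≤ n)
    {test : ℝ → Prog Ω d Bool} {N : ℕ} {β q ε : ℝ} (hε : 0 ≤ ε)
    (hq : ∀ x, β ≤ x → x ≤ q → (test x).QueriesLe N)
    (ht : ∀ x, β ≤ x → x ≤ q → 1 - ε ≤ prob H (test x) (gibbsInit H β)
      (fun b _ φ => TestSound H β x b ∧ IsGibbs H β φ))
    (M : ℕ) {lo hi : ℝ} (hlo : β ≤ lo) (hlh : lo ≤ hi) (hhi : hi ≤ q)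
    (hovlo : 0.07 ≤ overlap H β lo) (hovhi : overlap H β hi ≤ 0.08)
    (hM : hi - lo ≤ 1 / (2 * n) * 2 ^ M) :
    1 - M * ε ≤ prob H (binarySearchLoop test (1 / (2 * n)) M lo hi) (gibbsInit H β)
      (fun b _ φ => SearchSound H q β b ∧ IsGibbs H β φ) := by
  have hn' : (0 : ℝ) < n := by exact_mod_cast hn
  have hfinal : ∀ {lo hi : ℝ}, β ≤ lo → lo ≤ hi → hi ≤ q → 0.07 ≤ overlap H β lo →
      overlap H β hi ≤ 0.08 → hi - lo ≤ 1 / (2 * n) → SearchSound H q β lo := by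
    intro lo hi hlo hlh hhi hovlo hovhi hp
    refine ⟨hlo, hlh.trans hhi, hovlo, Or.inr ?_⟩
    have h1 := five_halves_le_convexityGap hovhi
    have h2 := convexityGap_le_add hH β hlh
    have h3 := mul_le_mul_of_nonneg_left hp hn'.le
    have h4 : (n : ℝ) * (1 / (2 * n)) = 1 / 2 := by
      field_simp
    linarith
  induction M generalizing lo hi with
  | zero =>
    -- When the iteration bound is used up, `hM` says that the interval is already within the
    -- precision.
    rw [pow_zero, mul_one] at hM
    rw [binarySearchLoop, prob_pure]
    · simp
    · exact ⟨hfinal hlo hlh hhi hovlo hovhi hM, isGibbs_gibbsInit H β⟩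
  | succ M ih =>
    have hMε : 0 ≤ (M : ℝ) * ε := by positivity
    rw [binarySearchLoop]
    split_ifs with hp
    · have hmid := ht ((lo + hi) / 2) (by linarith) (by linarith)
      have hM2 : (hi - lo) / 2 ≤ 1 / (2 * n) * 2 ^ M := by
        rw [pow_succ] at hM
        linarith
      refine le_trans (le_of_eq ?_) (prob_bind H (β' := fun _ => β) hMε hε
        (fun b s φ c h => ⟨h.1, h.2.smul c⟩) (hq ((lo + hi) / 2) (by linarith) (by linarith)) hmid
        fun t ht s hs => ?_)
      · push_cast
        ring
      · cases t
        · exact ih hlo (by linarith) (by linarith) hovlo ht (by linarith)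
        · exact ih (by linarith) (by linarith) hhi ht hovhi (by linarith)
    · rw [prob_pure]
      · have : 0 ≤ ((M + 1 : ℕ) : ℝ) * ε := by positivity
        linarith
      · exact ⟨hfinal hlo hlh hhi hovlo hovhi (not_lt.1 hp), isGibbs_gibbsInit H β⟩

/-- The number of tests of a binary search on `[β, q]` with precision `1 / (2n)`. -/
def searchTests (n : ℕ) (q β : ℝ) : ℕ := ⌈Real.logb 2 ((q - β) / (1 / (2 * n)))⌉₊ + 1

theorem queriesLe_binarySearch {test : ℝ → Prog Ω d Bool} {N : ℕ} {β q : ℝ} (hβ : β ≤ q)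
    (hq : ∀ x, β ≤ x → x ≤ q → (test x).QueriesLe N) (n : ℕ) :
    (binarySearch test β q (1 / (2 * n))).QueriesLe (searchTests n q β * N) := by
  refine ((hq q hβ le_rfl).bind fun t => ?_).mono
    (by rw [searchTests, Nat.succ_mul, add_comm])
  split_ifs
  · exact Prog.queriesLe_ret _ _
  · exact queriesLe_binarySearchLoop hq _ _ le_rfl hβ le_rfl

theorem binarySearch_correct {H : Ω → ℕ} {n : ℕ} (hn : 0 < n) (hH : ∀ x, H x ≤ n)
    {test : ℝ → Prog Ω d Bool} {N : ℕ} {β q ε : ℝ} (hβ : β < q) (hε : 0 ≤ ε)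
    (hq : ∀ x, β ≤ x → x ≤ q → (test x).QueriesLe N)
    (ht : ∀ x, β ≤ x → x ≤ q → 1 - ε ≤ prob H (test x) (gibbsInit H β)
      (fun b _ φ => TestSound H β x b ∧ IsGibbs H β φ)) :
    1 - searchTests n q β * ε ≤ prob H (binarySearch test β q (1 / (2 * n))) (gibbsInit H β)
      (fun b _ φ => SearchSound H q β b ∧ IsGibbs H β φ) := by
  have hn' : (0 : ℝ) < n := by exact_mod_cast hn
  set M := ⌈Real.logb 2 ((q - β) / (1 / (2 * n)))⌉₊ with hM
  have hMε : 0 ≤ (M : ℝ) * ε := by positivity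
  refine le_trans (le_of_eq ?_) (prob_bind H (β' := fun _ => β) hMε hε
    (fun b s φ c h => ⟨h.1, h.2.smul c⟩) (hq q hβ.le le_rfl) (ht q hβ.le le_rfl)
    fun t ht' s hs => ?_)
  · rw [searchTests, ← hM]
    push_cast
    ring
  · cases t
    · refine binarySearchLoop_correct hn hH hε hq ht M le_rfl hβ.le le_rfl ?_ ht' ?_
      · rw [overlap_eq_exp, convexityGap_self]
        norm_num
      · have h1 : 0 < (q - β) / (1 / (2 * n)) := div_pos (by linarith) (by positivity)
        have h2 : (q - β) / (1 / (2 * n)) ≤ 2 ^ M := by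
          rw [← Real.rpow_natCast, ← Real.logb_le_iff_le_rpow one_lt_two h1]
          exact Nat.le_ceil _
        rw [div_le_iff₀ (by positivity)] at h2
        linarith
    · rw [if_pos rfl, prob_pure]
      · linarith
      · exact ⟨⟨hβ.le, le_rfl, ht', Or.inl rfl⟩, isGibbs_gibbsInit H β⟩

theorem searchTests_le {n : ℕ} {q β : ℝ} (hn : 1 ≤ Real.log n) (hq : 1 ≤ Real.log q) (h0 : 0 ≤ β)
    (h : β < q) : (searchTests n q β : ℝ) ≤ 4 * (Real.log q + Real.log n) := by
  have hn0 : (0 : ℝ) < n := by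
    rcases Nat.eq_zero_or_pos n with rfl | hn0
    · norm_num at hn
    · exact_mod_cast hn0
  have hq0 : 0 < q := by linarith
  have hl2 := Real.log_two_gt_d9
  have h1 : Real.logb 2 ((q - β) / (1 / (2 * n))) ≤
      (Real.log 2 + (Real.log q + Real.log n)) / Real.log 2 := by
    rw [Real.logb]
    refine div_le_div_of_nonneg_right ?_ (by linarith)
    have h2 : Real.log 2 + (Real.log q + Real.log n) = Real.log (2 * (q * n)) := by
      rw [Real.log_mul (by norm_num) (by positivity), Real.log_mul hq0.ne' hn0.ne']
    rw [h2]
    refine Real.log_le_log (div_pos (by linarith) (by positivity)) ?_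
    rw [div_div_eq_mul_div, div_one]
    nlinarith
  have h2 : (⌈Real.logb 2 ((q - β) / (1 / (2 * n)))⌉₊ : ℝ) <
      (Real.log 2 + (Real.log q + Real.log n)) / Real.log 2 + 1 :=
    (Nat.cast_le.2 (Nat.ceil_mono h1)).trans_lt (Nat.ceil_lt_add_one (by positivity))
  -- With s = ln q + ln n ≥ 2 this gives at most 3 + 1.5s ≤ 4s tests; the 3 collects log₂ 2, the
  -- rounding and the test at q.
  have h3 : (Real.log 2 + (Real.log q + Real.log n)) / Real.log 2 ≤
      1 + 1.5 * (Real.log q + Real.log n) := by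
    rw [div_le_iff₀ (by linarith)]
    nlinarith
  rw [searchTests]
  push_cast
  linarith

/-! ### The main loop -/

/-- The temperatures found so far, with the current one at the end. -/
structure PartialSchedule (H : Ω → ℕ) (β₀ βmax : ℝ) (l : List ℝ) (β : ℝ) : Prop where
  head : (l ++ [β]).head? = some β₀
  chain : (l ++ [β]).IsChain (fun a b => a < b ∧ convexityGap H a b ≤ Real.log 15)
  lt : ∀ x ∈ l, x < βmax

theorem PartialSchedule.nil (H : Ω → ℕ) (β₀ βmax : ℝ) : PartialSchedule H β₀ βmax [] β₀ :=
  ⟨rfl, List.isChain_singleton _, by simp⟩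

theorem PartialSchedule.append {H : Ω → ℕ} {β₀ βmax β β' : ℝ} {l : List ℝ}
    (h : PartialSchedule H β₀ βmax l β) (hβ : β < βmax) (hββ' : β < β')
    (hg : convexityGap H β β' ≤ Real.log 15) : PartialSchedule H β₀ βmax (l ++ [β]) β' := by
  refine ⟨?_, ?_, ?_⟩
  · rw [List.head?_append, h.head]
    rfl
  · rw [List.isChain_append]
    refine ⟨h.chain, List.isChain_singleton _, ?_⟩
    simp only [List.getLast?_append, List.getLast?_singleton, Option.some_or, Option.mem_some_iff,
      List.head?_cons]
    rintro x rfl y rfl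
    exact ⟨hββ', hg⟩
  · intro x hx
    rcases List.mem_append.1 hx with hx | hx
    · exact h.lt x hx
    · rw [List.mem_singleton.1 hx]
      exact hβ

/-- Replacing the overshooting last temperature by βmax shortens the last step, which can only
decrease its gap. -/
theorem PartialSchedule.close {H : Ω → ℕ} {β₀ βmax β : ℝ} {l : List ℝ}
    (h : PartialSchedule H β₀ βmax l β) (h0 : β₀ < βmax) (hβ : βmax ≤ β) :
    IsCoolingSchedule β₀ βmax (l ++ [βmax]) ∧ SlowlyVarying H 15 (l ++ [βmax]) := by
  have hc := List.isChain_append.1 h.chain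
  have hchain : (l ++ [βmax]).IsChain (fun a b => a < b ∧ convexityGap H a b ≤ Real.log 15) := by
    refine List.isChain_append.2 ⟨hc.1, List.isChain_singleton _, ?_⟩
    intro x hx y hy
    have hy : y = βmax := by simpa using hy.symm
    subst hy
    have h1 := hc.2.2 x hx β (by simp)
    have h2 := h.lt x (List.mem_of_getLast? hx)
    exact ⟨h2, (convexityGap_mono H h2.le hβ).trans h1.2⟩
  refine ⟨⟨?_, by simp, hchain.imp fun _ _ h => h.1⟩, hchain.imp fun a b h => ?_⟩
  · cases l with
    | nil =>
      have : β = β₀ := by simpa using h.head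
      linarith
    | cons a l => exact h.head
  · rw [ratio_eq_exp]
    exact (Real.le_log_iff_exp_le (by norm_num)).1 h.2

/-- Each iteration may spend failure probability δ/X and K queries, and `l.length` counts the
iterations made. The invariant `hlong` is required only below βmax: there all steps so far were long
and one more iteration is affordable. -/
theorem scheduleLoop_correct {S : Subroutines Ω d} {C : ℝ} {H : Ω → ℕ}
    (hE : S.EstimateCorrect C H) (hM : S.MoveCorrect C H) {n : ℕ} {q β₀ βmax δ X s : ℝ} {K : ℕ}
    {η η' : ℝ} (hq : q = Real.log (Fintype.card Ω)) (hn1 : 1 ≤ Real.log n)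
    (hq1 : 1 ≤ Real.log q) (hnq : 10 ≤ n ∨ 36 ≤ q * Real.log n) (hβ₀ : 0 ≤ β₀) (h0m : β₀ < βmax)
    (hmq : βmax ≤ q) (hδ : 0 < δ) (hH : ∀ x, H x ≤ n) (hH0 : ∃ x, H x = 0)
    (hX : X = Real.sqrt (q * Real.log n)) (hX1 : 1 ≤ X) (hs : s = Real.log q + Real.log n)
    (hη0 : 0 < η) (hη1 : η ≤ 1 / 2) (hη'0 : 0 < η') (hη'1 : η' ≤ 1 / 2)
    (hηη' : 8 * s * η + η' ≤ δ / X)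
    (hK : ⌊4 * s⌋₊ * ⌊C * Real.log (1 / η)⌋₊ + ⌊C * Real.log (1 / η')⌋₊ ≤ K)
    (T : ℕ) {l : List ℝ} {β : ℝ} {m : ℕ} (hT : ⌊X⌋₊ ≤ T + l.length)
    (hl : PartialSchedule H β₀ βmax l β) (hlX : (l.length : ℝ) ≤ X) (hβ : 0 ≤ β)
    (hlong : β < βmax → LongSteps H β₀ l.length β ∧ (l.length : ℝ) + 1 ≤ X)
    (hm : m ≤ l.length * K) :
    1 - (X - l.length) * (δ / X) ≤
      prob H (scheduleLoop S n q βmax η η' T β l) (gibbsInit H β)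
        (fun out t _ => ∃ l : List ℝ, out = some l ∧ IsCoolingSchedule β₀ βmax l ∧
          SlowlyVarying H 15 l ∧ ((l.length - 1 : ℕ) : ℝ) ≤ X ∧ ((m + t : ℕ) : ℝ) ≤ X * K) := by
  have hδX : 0 < δ / X := by positivity
  have hn : 0 < n := by
    rcases Nat.eq_zero_or_pos n with rfl | hn0
    · norm_num at hn1
    · exact hn0
  have hend : βmax ≤ β → ∃ l' : List ℝ, some (l ++ [βmax]) = some l' ∧
      IsCoolingSchedule β₀ βmax l' ∧ SlowlyVarying H 15 l' ∧ ((l'.length - 1 : ℕ) : ℝ) ≤ X ∧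
      ((m + 0 : ℕ) : ℝ) ≤ X * K := fun h => by
    obtain ⟨h1, h2⟩ := hl.close h0m h
    refine ⟨_, rfl, h1, h2, by simpa using hlX, ?_⟩
    have h3 : (m : ℝ) ≤ l.length * K := by exact_mod_cast hm
    exact h3.trans (mul_le_mul_of_nonneg_right hlX (Nat.cast_nonneg K))
  induction T generalizing l β m with
  | zero =>
    have h1 : ¬ β < βmax := fun h => by
      have h2 := (hlong h).2
      have h3 : l.length + 1 ≤ ⌊X⌋₊ := Nat.le_floor (by exact_mod_cast h2)
      omega
    rw [scheduleLoop, if_neg h1, prob_pure]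
    · have := mul_nonneg (sub_nonneg.2 hlX) hδX.le
      linarith
    · exact hend (not_lt.1 h1)
  | succ T ih =>
    rw [scheduleLoop]
    split_ifs with h1
    · obtain ⟨hls, hlX1⟩ := hlong h1
      have hβq : β < q := by linarith
      have htest : ∀ x, β ≤ x → x ≤ q →
          1 - 2 * η ≤ prob H (overlapTest S η β x) (gibbsInit H β)
              (fun b _ φ => TestSound H β x b ∧ IsGibbs H β φ) ∧
            (overlapTest S η β x).QueriesLe ⌊C * Real.log (1 / η)⌋₊ := fun x hx _ =>
        overlapTest_correct hE hη0 hη1 hβ (hβ.trans hx)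
      have hbs := binarySearch_correct hn hH hβq (by linarith : (0 : ℝ) ≤ 2 * η)
        (fun x hx hx' => (htest x hx hx').2) (fun x hx hx' => (htest x hx hx').1)
      have hbq := queriesLe_binarySearch hβq.le (fun x hx hx' => (htest x hx hx').2) n
      have htests := searchTests_le hn1 hq1 hβ hβq
      rw [← hs] at htests
      have hbq' := hbq.mono (Nat.mul_le_mul_right _ (Nat.le_floor htests))
      -- At most 4s tests, each failing with probability at most 2η (accuracy and restoration), and
      -- one move failing with probability at most η'.
      have hsum : searchTests n q β * (2 * η) + (η' + (X - l.length - 1) * (δ / X)) ≤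
          (X - l.length) * (δ / X) := by
        have h2 := mul_le_mul_of_nonneg_right htests (by linarith : (0 : ℝ) ≤ 2 * η)
        linarith
      have hrest : 0 ≤ (X - l.length - 1) * (δ / X) := mul_nonneg (by linarith) hδX.le
      refine le_trans (sub_le_sub_left hsum 1) (prob_bind H (β' := fun _ => β) (by linarith)
        (by positivity) (fun _ _ _ _ h => h) hbq' hbs fun β' hβ' t ht => ?_)
      have hβ'0 : 0 ≤ β' := hβ.trans hβ'.le
      obtain ⟨hmove, N, hN, hNq⟩ := hM η' β β' hη'0 hη'1 hβ hβ'0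
      have hov : 1 / 15 ≤ overlap H β β' := le_trans (by norm_num) hβ'.overlap
      refine prob_bind H (A := fun _ => True) (β' := fun _ => β') hrest hη'0.le
        (fun _ _ _ _ h => h) (hNq.mono (Nat.le_floor hN)) (by simpa using hmove hov)
        fun _ _ t' ht' => ?_
      have hlt : β < β' := by
        refine lt_of_le_of_ne hβ'.le fun h => ?_
        rcases hβ'.long with h2 | h2
        · linarith
        · rw [← h, convexityGap_self] at h2
          linarith
      have hm' : m + (t + t') ≤ (l ++ [β]).length * K := by
        rw [List.length_append, List.length_singleton, Nat.succ_mul]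
        omega
      have hlen : ((l ++ [β]).length : ℝ) = l.length + 1 := by simp
      have hpart := hl.append h1 hlt (convexityGap_le_log_fifteen hβ'.overlap)
      have hnext := ih (l := l ++ [β]) (β := β') (m := m + (t + t'))
        (by rw [List.length_append, List.length_singleton]; omega) hpart (by rw [hlen]; exact hlX1)
        hβ'0 (fun h => by
          -- Below βmax ≤ q the search cannot have returned q, so the step was long.
          have hg : 2 ≤ convexityGap H β β' := hβ'.long.resolve_left (by linarith)
          rw [hlen]
          refine ⟨?_, ?_⟩
          · rw [List.length_append, List.length_singleton]
            exact hls.succ hlt.le hg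
          · have := hls.add_two_le hlt.le hg hq hn1 hq1 hnq hβ₀ hH hH0
            rw [hX]
            linarith) hm' (fun h => by
          obtain ⟨h2, h3⟩ := hpart.close h0m h
          refine ⟨_, rfl, h2, h3, ?_, ?_⟩
          · rw [List.length_append, List.length_singleton, Nat.add_sub_cancel, hlen]
            exact hlX1
          · have h4 : ((m + (t + t') : ℕ) : ℝ) ≤ (l ++ [β]).length * K := by exact_mod_cast hm'
            refine h4.trans (mul_le_mul_of_nonneg_right ?_ (Nat.cast_nonneg K))
            rw [hlen]
            exact hlX1)
      rw [hlen, ← sub_sub] at hnext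
      simpa only [add_assoc] using hnext
    · rw [prob_pure]
      · have := mul_nonneg (sub_nonneg.2 hlX) hδX.le
        linarith
      · exact hend (not_lt.1 h1)

end Schedule

/-! ### Choice of the parameters and the final bounds. -/

section Main

variable {Ω : Type u} [Fintype Ω] [DecidableEq Ω] {d : ℕ} [NeZero d]

theorem log_one_div_nonneg {η : ℝ} (h0 : 0 < η) (h1 : η ≤ 1 / 2) : 0 ≤ Real.log (1 / η) :=
  Real.log_nonneg ((one_le_div h0).2 (by linarith))

theorem Subroutines.EstimateCorrect.mono {S : Subroutines Ω d} {C C' : ℝ} {H : Ω → ℕ}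
    (h : S.EstimateCorrect C H) (hC : C ≤ C') : S.EstimateCorrect C' H :=
  fun η β β' h0 h1 hβ hβ' => by
    obtain ⟨ha, hr, N, hN, hq⟩ := h η β β' h0 h1 hβ hβ'
    exact ⟨ha, hr, N,
      hN.trans (mul_le_mul_of_nonneg_right hC (log_one_div_nonneg h0 h1)), hq⟩

theorem Subroutines.MoveCorrect.mono {S : Subroutines Ω d} {C C' : ℝ} {H : Ω → ℕ}
    (h : S.MoveCorrect C H) (hC : C ≤ C') : S.MoveCorrect C' H :=
  fun η β β' h0 h1 hβ hβ' => by
    obtain ⟨hm, N, hN, hq⟩ := h η β β' h0 h1 hβ hβ'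
    exact ⟨hm, N, hN.trans (mul_le_mul_of_nonneg_right hC (log_one_div_nonneg h0 h1)), hq⟩

/-- As ln q + ℓ ≤ 2ℓ ln q and ln ln q ≤ ln q, the numerical terms amount to 5 ln 2 < 3.5, which is
absorbed by ln q ≥ 1. -/
theorem log_one_div_failure_le {q ℓ δ : ℝ} (hq0 : 0 < q) (hq : 1 ≤ Real.log q) (hℓ : 1 ≤ ℓ)
    (hδ : 0 < δ) (hδ1 : δ < 1) :
    Real.log (1 / (δ / (16 * Real.sqrt (q * ℓ) * (Real.log q + ℓ)))) ≤
      5 * (Real.log q + Real.log ℓ + Real.log (1 / δ)) := by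
  have hℓ0 : 0 < ℓ := by linarith
  have hs : 0 < Real.log q + ℓ := by linarith
  have hX : 0 < Real.sqrt (q * ℓ) := Real.sqrt_pos.2 (by positivity)
  have hl2 := Real.log_two_lt_d9
  have hlδ : 0 ≤ Real.log (1 / δ) := Real.log_nonneg ((one_le_div hδ).2 hδ1.le)
  have hlℓ : 0 ≤ Real.log ℓ := Real.log_nonneg hℓ
  have h1 : 1 / (δ / (16 * Real.sqrt (q * ℓ) * (Real.log q + ℓ))) =
      16 * Real.sqrt (q * ℓ) * (Real.log q + ℓ) * (1 / δ) := by
    field_simp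
  have h2 : Real.log 16 = 4 * Real.log 2 := by
    rw [show (16 : ℝ) = 2 ^ 4 by norm_num, Real.log_pow]
    norm_num
  have h3 : Real.log (Real.log q + ℓ) ≤ Real.log 2 + Real.log q + Real.log ℓ := by
    have h4 : Real.log q + ℓ ≤ 2 * Real.log q * ℓ := by nlinarith
    have h5 := Real.log_le_log hs h4
    rw [Real.log_mul (by positivity) hℓ0.ne', Real.log_mul two_ne_zero (by positivity)] at h5
    have h6 := Real.log_le_sub_one_of_pos (by linarith : 0 < Real.log q)
    linarith
  rw [h1, Real.log_mul (by positivity) (by positivity), Real.log_mul (by positivity) hs.ne',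
    Real.log_mul (by norm_num) hX.ne', Real.log_sqrt (by positivity),
    Real.log_mul hq0.ne' hℓ0.ne', h2]
  linarith

theorem quantumSchedule_correct [Nonempty Ω] {S : Subroutines Ω d} {C : ℝ} (hC : 0 < C)
    {H : Ω → ℕ} (hE : S.EstimateCorrect C H) (hM : S.MoveCorrect C H) {n : ℕ} {q β₀ βmax δ : ℝ}
    (hq : q = Real.log (Fintype.card Ω)) (hn1 : 1 ≤ Real.log n) (hq1 : 1 ≤ Real.log q)
    (hnq : 10 ≤ n ∨ 36 ≤ q * Real.log n) (hβ₀ : 0 ≤ β₀) (h0m : β₀ < βmax) (hmq : βmax ≤ q)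
    (hδ : 0 < δ) (hδ1 : δ < 1) (hH : ∀ x, H x ≤ n) (hH0 : ∃ x, H x = 0) {T : ℕ}
    (hT : ⌊Real.sqrt (q * Real.log n)⌋₊ ≤ T) :
    1 - δ ≤ prob H (quantumSchedule S n β₀ βmax δ T) (gibbsInit H β₀)
      (fun out t _ => ∃ l : List ℝ, out = some l ∧ IsCoolingSchedule β₀ βmax l ∧
        SlowlyVarying H 15 l ∧ ((l.length - 1 : ℕ) : ℝ) ≤ Real.sqrt (q * Real.log n) ∧
        (t : ℝ) ≤ 25 * C * (Real.sqrt (q * Real.log n) * (Real.log q + Real.log n) *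
          (Real.log q + Real.log (Real.log n) + Real.log (1 / δ)))) := by
  have hq0 : 1 ≤ q := by
    have h1 := Real.log_le_sub_one_of_pos (by linarith : 0 < q)
    linarith
  have hX1 : 1 ≤ Real.sqrt (q * Real.log n) := Real.one_le_sqrt.2 (by nlinarith)
  have hη := log_one_div_failure_le (by linarith) hq1 hn1 hδ hδ1
  have hdef : quantumSchedule S n β₀ βmax δ T = scheduleLoop S n q βmax
      (δ / (16 * Real.sqrt (q * Real.log n) * (Real.log q + Real.log n)))
      (δ / (2 * Real.sqrt (q * Real.log n))) T β₀ [] := by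
    simp only [quantumSchedule, ← hq]
  rw [hdef]
  generalize hX : Real.sqrt (q * Real.log n) = X at *
  generalize hs : Real.log q + Real.log n = s at *
  have hs2 : 2 ≤ s := by linarith
  have hη0 : 0 < δ / (16 * X * s) := by positivity
  have hη'0 : 0 < δ / (2 * X) := by positivity
  have hXs : X * 2 ≤ X * s := mul_le_mul_of_nonneg_left hs2 (by linarith)
  have hη1 : δ / (16 * X * s) ≤ 1 / 2 := by
    rw [div_le_div_iff₀ (by positivity) two_pos]
    linarith
  have hη'1 : δ / (2 * X) ≤ 1 / 2 := by
    rw [div_le_div_iff₀ (by positivity) two_pos]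
    linarith
  have hηη' : 8 * s * (δ / (16 * X * s)) + δ / (2 * X) ≤ δ / X := by
    refine le_of_eq ?_
    field_simp
    norm_num
  have h := scheduleLoop_correct hE hM hq hn1 hq1 hnq hβ₀ h0m hmq hδ hH hH0 hX.symm hX1 hs.symm
    hη0 hη1 hη'0 hη'1 hηη' le_rfl T (l := []) (m := 0) (by simpa using hT)
    (PartialSchedule.nil H β₀ βmax) (by simp; linarith) hβ₀
    (fun _ => ⟨LongSteps.zero H β₀, by simpa using hX1⟩) (by simp)
  set L := Real.log (1 / (δ / (16 * X * s))) with hL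
  set L' := Real.log (1 / (δ / (2 * X))) with hL'
  have hL0 : 0 ≤ L := log_one_div_nonneg hη0 hη1
  have hL'0 : 0 ≤ L' := log_one_div_nonneg hη'0 hη'1
  have hLL' : L' ≤ L := by
    refine Real.log_le_log (by positivity) (one_div_le_one_div_of_le hη0 ?_)
    exact div_le_div_of_nonneg_left hδ.le (by positivity) (by linarith)
  have hK : ((⌊4 * s⌋₊ * ⌊C * L⌋₊ + ⌊C * L'⌋₊ : ℕ) : ℝ) ≤ 5 * s * (C * L) := by
    push_cast
    have h1 : (⌊4 * s⌋₊ : ℝ) ≤ 4 * s := Nat.floor_le (by positivity)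
    have h2 : (⌊C * L⌋₊ : ℝ) ≤ C * L := Nat.floor_le (by positivity)
    have h3 : (⌊C * L'⌋₊ : ℝ) ≤ C * L' := Nat.floor_le (by positivity)
    have h4 : (⌊4 * s⌋₊ : ℝ) * ⌊C * L⌋₊ ≤ 4 * s * (C * L) :=
      mul_le_mul h1 h2 (Nat.cast_nonneg _) (by positivity)
    have h5 : C * L' ≤ C * L := mul_le_mul_of_nonneg_left hLL' hC.le
    have h6 : 0 ≤ C * L := by positivity
    nlinarith
  have hδe : 1 - (X - ([] : List ℝ).length) * (δ / X) = 1 - δ := by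
    have : X ≠ 0 := by linarith
    simp
    field_simp
  rw [hδe] at h
  refine h.trans (sumBranches_mono H _ 0 _ fun out t φ => ?_)
  have hφ := normSq_nonneg φ
  split_ifs with h1 h2
  · rfl
  · exfalso
    obtain ⟨l, ha, hb, hc, hd, he⟩ := h1
    refine h2 ⟨l, ha, hb, hc, hd, ?_⟩
    rw [zero_add] at he
    refine he.trans ((mul_le_mul_of_nonneg_left hK (by linarith)).trans ?_)
    have h3 := mul_le_mul_of_nonneg_left hη (by positivity : 0 ≤ 5 * X * s * C)
    linarith
  · exact hφ
  · rfl

end Main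

end GibbsSchedule

end

theorem theorem3p4 :
    ∃ C : ℝ, 0 < C ∧
      ∀ (Ω : Type*) [Fintype Ω] [DecidableEq Ω] [Nonempty Ω],
      ∃ (d : ℕ) (_ : NeZero d) (S : GibbsSchedule.Subroutines Ω d),
        (∀ H : Ω → ℕ, S.EstimateCorrect C H ∧ S.MoveCorrect C H) ∧
        ∀ (n : ℕ) (q β₀ βmax δ : ℝ),
          q = Real.log (Fintype.card Ω) →
          1 ≤ Real.log n → 1 ≤ Real.log q →
          (10 ≤ n ∨ 36 ≤ q * Real.log n) →
          0 ≤ β₀ → β₀ < βmax → βmax ≤ q →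
          0 < δ → δ < 1 →
          ∀ H : Ω → ℕ, (∀ x, H x ≤ n) → (∃ x, H x = 0) →
          ∀ T : ℕ, ⌊Real.sqrt (q * Real.log n)⌋₊ ≤ T →
            1 - δ ≤ GibbsSchedule.prob H
              (GibbsSchedule.quantumSchedule S n β₀ βmax δ T)
              (GibbsSchedule.gibbsInit H β₀)
              (fun out t _ => ∃ l : List ℝ, out = some l ∧
                GibbsSchedule.IsCoolingSchedule β₀ βmax l ∧
                GibbsSchedule.SlowlyVarying H 15 l ∧
                ((l.length - 1 : ℕ) : ℝ) ≤ Real.sqrt (q * Real.log n) ∧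
                (t : ℝ) ≤ C * (Real.sqrt (q * Real.log n) * (Real.log q + Real.log n) *
                  (Real.log q + Real.log (Real.log n) + Real.log (1 / δ)))) := by
  -- 60000000 is the constant of the subroutines. One factor 5 comes from 4s searches and a move per
  -- iteration (s ≥ 1), the other from the bound on ln(1/η).
  refine ⟨25 * 60000000, by norm_num, fun Ω _ _ _ => ⟨4, inferInstance,
    GibbsSchedule.walkSubroutines Ω, fun H =>
      ⟨(GibbsSchedule.walkSubroutines_estimateCorrect H).mono (by norm_num),
        (GibbsSchedule.walkSubroutines_moveCorrect H).mono (by norm_num)⟩, ?_⟩⟩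
  intro n q β₀ βmax δ hq hn1 hq1 hnq hβ₀ h0m hmq hδ hδ1 H hH hH0 T hT
  exact GibbsSchedule.quantumSchedule_correct (by norm_num)
    (GibbsSchedule.walkSubroutines_estimateCorrect H)
    (GibbsSchedule.walkSubroutines_moveCorrect H) hq hn1 hq1 hnq hβ₀ h0m hmq hδ hδ1 hH hH0 hT
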